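/- Let $A$ be a quasi-Frobenius (QF) ring, i.e. a ring that is Artinian and self-injective on both sides, and let $(\mathcal{C},\Delta,\varepsilon)$ be a non-zero $A$-coring, with $\Delta(c)=\sum c_1\otimes_A c_2$. Let $\mathcal{C}^{\ast}=\mathrm{Hom}_{-A}(\mathcal{C},A)$ and ${}^{\ast}\mathcal{C}=\mathrm{Hom}_{A-}(\mathcal{C},A)$ be the dual rings, with unity $\varepsilon$ and products $(f\ast^r g)(c)=\sum g(f(c_1)c_2)$ and $(f\ast^l g)(c)=\sum f(c_1g(c_2))$ respectively. Then $\mathcal{C}$ is a right $\mathcal{C}^{\ast}$-module by $c\leftharpoonup g=\sum g(c_1)c_2$ and a left ${}^{\ast}\mathcal{C}$-module by $f\rightharpoonup c=\sum c_1f(c_2)$. Conventions. A ring $T\neq 0$ is prime if $IJ=0$ implies $I=0$ or $J=0$ for all two-sided ideals $I,J$. A non-zero $T$-module $M$ is: prime if $\mathrm{ann}_T(K)=\mathrm{ann}_T(M)$ for every non-zero submodule $K$; diprime if $\mathrm{ann}_T(K)=\mathrm{ann}_T(M)$ or $\mathrm{ann}_T(M/K)=\mathrm{ann}_T(M)$ for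 every submodule $0\neq K\subsetneq M$; strongly prime if for every non-zero submodule $K$, $M$ is isomorphic to a submodule of a quotient of a direct sum of copies of $K$. A right (left) $\mathcal{C}$-coideal is a right (left) $\mathcal{C}$-subcomodule of $\mathcal{C}$; it is fully invariant if it is stable under all right (left) $\mathcal{C}$-colinear endomorphisms of $\mathcal{C}$. $\mathcal{C}^r$ (resp. $\mathcal{C}^l$) denotes $\mathcal{C}$ as a right (resp. left) $\mathcal{C}$-comodule; it is fully coprime if for all fully invariant right (resp. left) coideals $X,Y$ such that $f(\mathcal{C})\subseteq Y$ for every right (resp. left) colinear endomorphism $f$ of $\mathcal{C}$ with $f(X)=0$, one has $X=\mathcal{C}$ or $Y=\mathcal{C}$. Theorem. Assume that ${}_A\mathcal{C}$ and $\mathcal{C}_A$ are projective, that $\mathcal{C}^{\ast}$ is right Artinian and that ${}^{\ast}\mathcal{C}$ is left Artinian. Then the following fifteen statements, namely (1)–(7), each in its first and in its second version, and (8), are all equivalent: (1) $\mathcal{C}^{\ast}$ is prime; ${}^{\ast}\mathcal{C}$ is prime. (2) $\mathcal{C}_{\mathcal{C}^{\ast}}$ is diprime; ${}_{{}^{\ast}\mathcal{C}}\mathcal{C}$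 is diprime. (3) $\mathcal{C}_{\mathcal{C}^{\ast}}$ is prime; ${}_{{}^{\ast}\mathcal{C}}\mathcal{C}$ is prime. (4) $\mathcal{C}^{\ast}$ is simple Artinian; ${}^{\ast}\mathcal{C}$ is simple Artinian. (5) $\mathcal{C}_{\mathcal{C}^{\ast}}$ is strongly prime; ${}_{{}^{\ast}\mathcal{C}}\mathcal{C}$ is strongly prime. (6) $\mathcal{C}^{r}$ is fully coprime; $\mathcal{C}^{l}$ is fully coprime. (7) $\mathcal{C}$ has no non-trivial fully invariant right $\mathcal{C}$-coideals (i.e. none other than $0$ and $\mathcal{C}$); $\mathcal{C}$ has no non-trivial fully invariant left $\mathcal{C}$-coideals. (8) $\mathcal{C}$ is simple, i.e. $0$ and $\mathcal{C}$ are its only $({}^{\ast}\mathcal{C},\mathcal{C}^{\ast})$-subbimodules. -/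

import Mathlib

open MulOpposite
open scoped TensorProduct

/-! Right modules over `A` are modules over `Aᵐᵒᵖ`, so `op a • m` is `m a`.  An `(A, A)`-bimodule
is an abelian group with `Module A M`, `Module Aᵐᵒᵖ M` and `SMulCommClass A Aᵐᵒᵖ M`. -/

/-! ### The tensor product over a noncommutative ring -/

section BalancedTensor

/-- The relations `m a ⊗ n = m ⊗ a n`. -/
def balancedRel (A M N : Type*) [Ring A] [AddCommGroup M] [AddCommGroup N]
    [Module Aᵐᵒᵖ M] [Module A N] : AddSubgroup (M ⊗[ℤ] N) :=
  AddSubgroup.closure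
    {t | ∃ (m : M) (a : A) (n : N), t = (op a • m) ⊗ₜ[ℤ] n - m ⊗ₜ[ℤ] (a • n)}

/-- The tensor product `M ⊗_A N` of a right `A`-module and a left `A`-module. -/
def BTensor (A M N : Type*) [Ring A] [AddCommGroup M] [AddCommGroup N]
    [Module Aᵐᵒᵖ M] [Module A N] : Type _ :=
  (M ⊗[ℤ] N) ⧸ balancedRel A M N

namespace BTensor

section Basic

variable {A M N : Type*} [Ring A] [AddCommGroup M] [AddCommGroup N]
  [Module Aᵐᵒᵖ M] [Module A N]

instance : AddCommGroup (BTensor A M N) :=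
  inferInstanceAs (AddCommGroup ((M ⊗[ℤ] N) ⧸ balancedRel A M N))

/-- The pure tensor `m ⊗ n`. -/
def tmul (A : Type*) {M N : Type*} [Ring A] [AddCommGroup M] [AddCommGroup N]
    [Module Aᵐᵒᵖ M] [Module A N] (m : M) (n : N) : BTensor A M N :=
  QuotientAddGroup.mk' (balancedRel A M N) (m ⊗ₜ[ℤ] n)

theorem add_tmul (m m' : M) (n : N) : tmul A (m + m') n = tmul A m n + tmul A m' n := by
  simp only [tmul, TensorProduct.add_tmul]; exact map_add _ _ _

theorem zero_tmul (n : N) : tmul A (0 : M) n = 0 := by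
  simp only [tmul, TensorProduct.zero_tmul]; exact map_zero _

theorem tmul_add (m : M) (n n' : N) : tmul A m (n + n') = tmul A m n + tmul A m n' := by
  simp only [tmul, TensorProduct.tmul_add]; exact map_add _ _ _

theorem smul_tmul (m : M) (a : A) (n : N) : tmul A (op a • m) n = tmul A m (a • n) := by
  refine (QuotientAddGroup.eq_iff_sub_mem).2 ?_
  exact AddSubgroup.subset_closure ⟨m, a, n, rfl⟩

@[elab_as_elim]
theorem induction_on {P : BTensor A M N → Prop} (t : BTensor A M N) (h0 : P 0)
    (ht : ∀ m n, P (tmul A m n)) (ha : ∀ s t, P s → P t → P (s + t)) : P t := by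
  obtain ⟨x, rfl⟩ := QuotientAddGroup.mk'_surjective (balancedRel A M N) t
  induction x using TensorProduct.induction_on with
  | zero => exact (map_zero (QuotientAddGroup.mk' (balancedRel A M N))) ▸ h0
  | tmul m n => exact ht m n
  | add x y hx hy =>
    exact (map_add (QuotientAddGroup.mk' (balancedRel A M N)) x y) ▸ ha _ _ hx hy

/-- The map out of `M ⊗_A N` induced by a balanced biadditive map. -/
def lift {P : Type*} [AddCommGroup P] (f : M →+ N →+ P)
    (hf : ∀ (m : M) (a : A) (n : N), f (op a • m) n = f m (a • n)) : BTensor A M N →+ P :=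
  QuotientAddGroup.lift (balancedRel A M N)
    (TensorProduct.liftAddHom (R := ℤ) f (by intro r m n; simp))
    (by
      rw [balancedRel, AddSubgroup.closure_le]
      rintro _ ⟨m, a, n, rfl⟩
      simp [AddMonoidHom.mem_ker, hf])

@[simp]
theorem lift_tmul {P : Type*} [AddCommGroup P] (f : M →+ N →+ P)
    (hf : ∀ (m : M) (a : A) (n : N), f (op a • m) n = f m (a • n)) (m : M) (n : N) :
    lift f hf (tmul A m n) = f m n := rfl

theorem hom_ext {P : Type*} [AddCommGroup P] {f g : BTensor A M N →+ P}
    (h : ∀ m n, f (tmul A m n) = g (tmul A m n)) : f = g := by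
  ext t
  induction t using induction_on with
  | h0 => simp
  | ht m n => exact h m n
  | ha s t hs ht => simp [hs, ht]

/-- The biadditive map `(m, n) ↦ m ⊗ n`. -/
def mk (A M N : Type*) [Ring A] [AddCommGroup M] [AddCommGroup N]
    [Module Aᵐᵒᵖ M] [Module A N] : M →+ N →+ BTensor A M N :=
  AddMonoidHom.mk' (fun m => AddMonoidHom.mk' (fun n => tmul A m n) (tmul_add m))
    (fun m m' => by ext n; exact add_tmul m m' n)

@[simp]
theorem mk_apply (m : M) (n : N) : mk A M N m n = tmul A m n := rfl

/-- The map `f ⊗ g` for `f` right `A`-linear and `g` left `A`-linear. -/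
def map {M' N' : Type*} [AddCommGroup M'] [AddCommGroup N'] [Module Aᵐᵒᵖ M'] [Module A N']
    (f : M →ₗ[Aᵐᵒᵖ] M') (g : N →ₗ[A] N') : BTensor A M N →+ BTensor A M' N' :=
  lift (((mk A M' N').comp f.toAddMonoidHom).flip.comp g.toAddMonoidHom).flip
    (by intro m a n; simp [smul_tmul])

@[simp]
theorem map_tmul {M' N' : Type*} [AddCommGroup M'] [AddCommGroup N'] [Module Aᵐᵒᵖ M']
    [Module A N'] (f : M →ₗ[Aᵐᵒᵖ] M') (g : N →ₗ[A] N') (m : M) (n : N) :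
    map f g (tmul A m n) = tmul A (f m) (g n) := rfl

end Basic

section Bimodule

variable {A M N : Type*} [Ring A] [AddCommGroup M] [AddCommGroup N]

/-- `M ⊗_A N` is a left module through a bimodule `M`. -/
instance leftModule [Module A M] [Module Aᵐᵒᵖ M] [SMulCommClass A Aᵐᵒᵖ M] [Module A N] :
    Module A (BTensor A M N) where
  smul a := map (Module.toModuleEnd Aᵐᵒᵖ (S := A) M a) LinearMap.id
  one_smul t := by
    induction t using induction_on with
    | h0 => exact map_zero _
    | ht m n => exact congrArg (tmul A · n) (one_smul A m)
    | ha s t hs ht => exact (map_add _ _ _).trans (congrArg₂ _ hs ht)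
  mul_smul a b t := by
    induction t using induction_on with
    | h0 => exact ((map_zero _).trans (map_zero _).symm).trans
              (congrArg _ (map_zero _).symm)
    | ht m n => exact congrArg (tmul A · n) (mul_smul a b m)
    | ha s t hs ht =>
      exact (map_add _ _ _).trans ((congrArg₂ _ hs ht).trans
        ((map_add _ _ _).symm.trans (congrArg _ (map_add _ _ _).symm)))
  smul_zero a := map_zero _
  smul_add a s t := map_add _ _ _
  add_smul a b t := by
    induction t using induction_on with
    | h0 => exact (map_zero _).trans
              ((add_zero (0 : BTensor A M N)).symm.trans
                (congrArg₂ _ (map_zero _).symm (map_zero _).symm))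
    | ht m n => exact (congrArg (tmul A · n) (add_smul a b m)).trans (add_tmul _ _ _)
    | ha s t hs ht =>
      refine (map_add _ _ _).trans ((congrArg₂ _ hs ht).trans ?_)
      refine (add_add_add_comm _ _ _ _).trans ?_
      exact congrArg₂ _ (map_add _ _ _).symm (map_add _ _ _).symm
  zero_smul t := by
    induction t using induction_on with
    | h0 => exact map_zero _
    | ht m n =>
      refine (congrArg (tmul A · n) (zero_smul A m)).trans ?_
      exact congrArg (fun f : N →+ BTensor A M N => f n) (map_zero (mk A M N))
    | ha s t hs ht => exact (map_add _ _ _).trans ((congrArg₂ _ hs ht).trans (add_zero _))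

@[simp]
theorem left_smul_tmul [Module A M] [Module Aᵐᵒᵖ M] [SMulCommClass A Aᵐᵒᵖ M] [Module A N]
    (a : A) (m : M) (n : N) : a • tmul A m n = tmul A (a • m) n := rfl

/-- `M ⊗_A N` is a right module through a bimodule `N`. -/
instance rightModule [Module Aᵐᵒᵖ M] [Module A N] [Module Aᵐᵒᵖ N] [SMulCommClass A Aᵐᵒᵖ N] :
    Module Aᵐᵒᵖ (BTensor A M N) where
  smul a := map LinearMap.id
    (haveI := SMulCommClass.symm A Aᵐᵒᵖ N; Module.toModuleEnd A (S := Aᵐᵒᵖ) N a)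
  one_smul t := by
    induction t using induction_on with
    | h0 => exact map_zero _
    | ht m n => exact congrArg (tmul A m ·) (one_smul Aᵐᵒᵖ n)
    | ha s t hs ht => exact (map_add _ _ _).trans (congrArg₂ _ hs ht)
  mul_smul a b t := by
    induction t using induction_on with
    | h0 => exact ((map_zero _).trans (map_zero _).symm).trans
              (congrArg _ (map_zero _).symm)
    | ht m n => exact congrArg (tmul A m ·) (mul_smul a b n)
    | ha s t hs ht =>
      exact (map_add _ _ _).trans ((congrArg₂ _ hs ht).trans
        ((map_add _ _ _).symm.trans (congrArg _ (map_add _ _ _).symm)))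
  smul_zero a := map_zero _
  smul_add a s t := map_add _ _ _
  add_smul a b t := by
    induction t using induction_on with
    | h0 => exact (map_zero _).trans
              ((add_zero (0 : BTensor A M N)).symm.trans
                (congrArg₂ _ (map_zero _).symm (map_zero _).symm))
    | ht m n => exact (congrArg (tmul A m ·) (add_smul a b n)).trans (tmul_add _ _ _)
    | ha s t hs ht =>
      refine (map_add _ _ _).trans ((congrArg₂ _ hs ht).trans ?_)
      refine (add_add_add_comm _ _ _ _).trans ?_
      exact congrArg₂ _ (map_add _ _ _).symm (map_add _ _ _).symm
  zero_smul t := by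
    induction t using induction_on with
    | h0 => exact map_zero _
    | ht m n =>
      refine (congrArg (tmul A m ·) (zero_smul Aᵐᵒᵖ n)).trans ?_
      exact map_zero (mk A M N m)
    | ha s t hs ht => exact (map_add _ _ _).trans ((congrArg₂ _ hs ht).trans (add_zero _))

@[simp]
theorem right_smul_tmul [Module Aᵐᵒᵖ M] [Module A N] [Module Aᵐᵒᵖ N] [SMulCommClass A Aᵐᵒᵖ N]
    (a : Aᵐᵒᵖ) (m : M) (n : N) : a • tmul A m n = tmul A m (a • n) := rfl

end Bimodule

/-- For fixed `t = m ⊗ n`, the map `p ↦ m ⊗ (n ⊗ p)`. -/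
def assocAux (A M N P : Type*) [Ring A] [AddCommGroup M] [AddCommGroup N] [AddCommGroup P]
    [Module Aᵐᵒᵖ M] [Module A N] [Module Aᵐᵒᵖ N] [SMulCommClass A Aᵐᵒᵖ N] [Module A P] :
    BTensor A M N →+ P →+ BTensor A M (BTensor A N P) :=
  lift
    (AddMonoidHom.mk'
      (fun m => AddMonoidHom.mk' (fun n => (mk A M (BTensor A N P) m).comp (mk A N P n))
        (fun n n' => by
          ext p
          exact (congrArg (tmul A m) (add_tmul n n' p)).trans (tmul_add _ _ _)))
      (fun m m' => by
        ext n p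
        exact add_tmul m m' (tmul A n p)))
    (by
      intro m a n
      ext p
      exact smul_tmul m a (tmul A n p))

/-- The canonical map `(M ⊗_A N) ⊗_A P → M ⊗_A (N ⊗_A P)`, `(m ⊗ n) ⊗ p ↦ m ⊗ (n ⊗ p)`. -/
def assoc (A M N P : Type*) [Ring A] [AddCommGroup M] [AddCommGroup N] [AddCommGroup P]
    [Module Aᵐᵒᵖ M] [Module A N] [Module Aᵐᵒᵖ N] [SMulCommClass A Aᵐᵒᵖ N] [Module A P] :
    BTensor A (BTensor A M N) P →+ BTensor A M (BTensor A N P) :=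
  lift (assocAux A M N P)
    (by
      intro t a p
      induction t using induction_on with
      | h0 =>
        rw [smul_zero, map_zero, AddMonoidHom.zero_apply, AddMonoidHom.zero_apply]
      | ht m n => exact congrArg (tmul A m) (smul_tmul n a p)
      | ha s t hs ht =>
        rw [smul_add, map_add, map_add, AddMonoidHom.add_apply, AddMonoidHom.add_apply, hs, ht])

@[simp]
theorem assoc_tmul {A M N P : Type*} [Ring A] [AddCommGroup M] [AddCommGroup N]
    [AddCommGroup P] [Module Aᵐᵒᵖ M] [Module A N] [Module Aᵐᵒᵖ N] [SMulCommClass A Aᵐᵒᵖ N]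
    [Module A P] (m : M) (n : N) (p : P) :
    assoc A M N P (tmul A (tmul A m n) p) = tmul A m (tmul A n p) := rfl

end BTensor

end BalancedTensor

/-! ### Corings and their dual rings -/

namespace BTensor

variable {A M N : Type*} [Ring A] [AddCommGroup M] [AddCommGroup N]
  [Module Aᵐᵒᵖ M] [Module A N]

/-- For a right `A`-linear `f : M → A`, the map `m ⊗ n ↦ f(m) n`. -/
def evalLeft (f : M →ₗ[Aᵐᵒᵖ] A) : BTensor A M N →+ N :=
  lift (((smulAddHom A N).comp f.toAddMonoidHom))
    (by intro m a n; simp [mul_smul])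

@[simp]
theorem evalLeft_tmul (f : M →ₗ[Aᵐᵒᵖ] A) (m : M) (n : N) :
    evalLeft f (tmul A m n) = f m • n := rfl

/-- For a left `A`-linear `f : N → A`, the map `m ⊗ n ↦ m f(n)`. -/
def evalRight (f : N →ₗ[A] A) : BTensor A M N →+ M :=
  lift (((smulAddHom Aᵐᵒᵖ M).comp (opAddEquiv.toAddMonoidHom.comp f.toAddMonoidHom)).flip)
    (by intro m a n; simp [mul_smul])

@[simp]
theorem evalRight_tmul (f : N →ₗ[A] A) (m : M) (n : N) :
    evalRight f (tmul A m n) = op (f n) • m := rfl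

end BTensor

namespace BTensor

/-- `evalRight f` as a left `A`-linear map on `M ⊗_A N`, for `M` a bimodule. -/
def evalRightL {A M N : Type*} [Ring A] [AddCommGroup M] [AddCommGroup N] [Module A M]
    [Module Aᵐᵒᵖ M] [SMulCommClass A Aᵐᵒᵖ M] [Module A N] (f : N →ₗ[A] A) :
    BTensor A M N →ₗ[A] M where
  toFun := evalRight f
  map_add' := map_add _
  map_smul' a s := by
    rw [RingHom.id_apply]
    induction s using induction_on with
    | h0 => simp only [smul_zero, map_zero]
    | ht m n => exact (smul_comm _ _ _).symm
    | ha s t hs ht => rw [smul_add, map_add, map_add, hs, ht, smul_add]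

end BTensor

open BTensor

/-- The data of a coring: `(A, A)`-bilinear maps `Δ : C → C ⊗_A C` and `ε : C → A`. -/
class CoringStruct (A C : Type*) [Ring A] [AddCommGroup C] [Module A C] [Module Aᵐᵒᵖ C]
    [SMulCommClass A Aᵐᵒᵖ C] where
  /-- The coproduct `Δ`. -/
  comul : C →+ BTensor A C C
  comul_smul : ∀ (a : A) (c : C), comul (a • c) = a • comul c
  comul_op_smul : ∀ (a : Aᵐᵒᵖ) (c : C), comul (a • c) = a • comul c
  /-- The counit `ε`. -/
  counit : C →+ A
  counit_smul : ∀ (a : A) (c : C), counit (a • c) = a * counit c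
  counit_op_smul : ∀ (a : A) (c : C), counit (op a • c) = counit c * a

namespace CoringStruct

variable (A C : Type*) [Ring A] [AddCommGroup C] [Module A C] [Module Aᵐᵒᵖ C]
  [SMulCommClass A Aᵐᵒᵖ C] [CoringStruct A C]

/-- `Δ` as a left `A`-linear map. -/
def comulL : C →ₗ[A] BTensor A C C where
  toFun := comul
  map_add' := map_add _
  map_smul' := comul_smul

/-- `Δ` as a right `A`-linear map. -/
def comulR : C →ₗ[Aᵐᵒᵖ] BTensor A C C where
  toFun := comul
  map_add' := map_add _
  map_smul' := comul_op_smul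

/-- `ε` as a left `A`-linear map. -/
def counitL : C →ₗ[A] A where
  toFun := counit
  map_add' := map_add _
  map_smul' := counit_smul

/-- `ε` as a right `A`-linear map. -/
def counitR : C →ₗ[Aᵐᵒᵖ] A where
  toFun := counit
  map_add' := map_add _
  map_smul' a c := counit_op_smul (unop a) c

end CoringStruct

open CoringStruct

/-- An `A`-coring: an `(A, A)`-bimodule `C` with `(A, A)`-bilinear maps `Δ : C → C ⊗_A C` and
`ε : C → A` that satisfy coassociativity and the two counit laws. -/
class Coring (A C : Type*) [Ring A] [AddCommGroup C] [Module A C] [Module Aᵐᵒᵖ C]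
    [SMulCommClass A Aᵐᵒᵖ C] extends CoringStruct A C where
  coassoc : ∀ c : C, assoc A C C C (map (comulR A C) LinearMap.id (comul c)) =
    map LinearMap.id (comulL A C) (comul c)
  /-- `∑ ε(c₁) c₂ = c` -/
  counit_left : ∀ c : C, evalLeft (counitR A C) (comul c : BTensor A C C) = c
  /-- `∑ c₁ ε(c₂) = c` -/
  counit_right : ∀ c : C, evalRight (counitL A C) (comul c : BTensor A C C) = c

section Dual

variable (A C : Type*) [Ring A] [AddCommGroup C] [Module A C] [Module Aᵐᵒᵖ C]
  [SMulCommClass A Aᵐᵒᵖ C]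

/-- `C* = Hom_{-A}(C, A)`, the right `A`-linear maps. -/
def RightDual : Type _ := C →ₗ[Aᵐᵒᵖ] A

/-- `*C = Hom_{A-}(C, A)`, the left `A`-linear maps. -/
def LeftDual : Type _ := C →ₗ[A] A

instance : AddCommGroup (RightDual A C) := inferInstanceAs (AddCommGroup (C →ₗ[Aᵐᵒᵖ] A))

instance : AddCommGroup (LeftDual A C) := inferInstanceAs (AddCommGroup (C →ₗ[A] A))

variable {A C} [Coring A C]

/-- The right action `c ↼ f = ∑ f(c₁) c₂` of a right `A`-linear `f : C → A` on `C`. -/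
def actR (f : C →ₗ[Aᵐᵒᵖ] A) : C →ₗ[Aᵐᵒᵖ] C where
  toFun c := evalLeft f (comul c)
  map_add' c d := by rw [map_add, map_add]
  map_smul' a c := by
    rw [comul_op_smul, RingHom.id_apply]
    generalize (comul c : BTensor A C C) = t
    induction t using BTensor.induction_on with
    | h0 => simp
    | ht m n => exact smul_comm _ _ _
    | ha s t hs ht => rw [smul_add, map_add, map_add, hs, ht, smul_add]

/-- The left action `f ⇀ c = ∑ c₁ f(c₂)` of a left `A`-linear `f : C → A` on `C`. -/
def actL (f : C →ₗ[A] A) : C →ₗ[A] C where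
  toFun c := evalRight f (comul c)
  map_add' c d := by rw [map_add, map_add]
  map_smul' a c := by
    rw [comul_smul, RingHom.id_apply]
    generalize (comul c : BTensor A C C) = t
    induction t using BTensor.induction_on with
    | h0 => simp
    | ht m n => exact (smul_comm _ _ _).symm
    | ha s t hs ht => rw [smul_add, map_add, map_add, hs, ht, smul_add]

theorem comul_actR (f : C →ₗ[Aᵐᵒᵖ] A) (c : C) :
    (comul (actR f c) : BTensor A C C) = map (actR f) LinearMap.id (comul c) := by
  have h1 : ∀ t : BTensor A C C, comul (evalLeft f t) =
      evalLeft f (map LinearMap.id (comulL A C) t) := by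
    intro t
    induction t using BTensor.induction_on with
    | h0 => simp only [map_zero]
    | ht m n => exact comul_smul _ _
    | ha s t hs ht => simp only [map_add, hs, ht]
  have h2 : ∀ (s : BTensor A C C) (z : C),
      evalLeft f (assoc A C C C (tmul A s z)) = tmul A (evalLeft f s) z := by
    intro s z
    induction s using BTensor.induction_on with
    | h0 => simp only [zero_tmul, map_zero]
    | ht m n => rfl
    | ha s t hs ht => simp only [add_tmul, map_add, hs, ht]
  have h3 : ∀ t : BTensor A C C,
      evalLeft f (assoc A C C C (map (comulR A C) LinearMap.id t)) =
        map (actR f) LinearMap.id t := by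
    intro t
    induction t using BTensor.induction_on with
    | h0 => simp only [map_zero]
    | ht m n => exact h2 (comul m) n
    | ha s t hs ht => simp only [map_add, hs, ht]
  exact (h1 _).trans ((congrArg _ (Coring.coassoc c).symm).trans (h3 _))

theorem comul_actL (f : C →ₗ[A] A) (c : C) :
    (comul (actL f c) : BTensor A C C) = map LinearMap.id (actL f) (comul c) := by
  have h1 : ∀ t : BTensor A C C, comul (evalRight f t) =
      evalRight f (map (comulR A C) LinearMap.id t) := by
    intro t
    induction t using BTensor.induction_on with
    | h0 => simp only [map_zero]
    | ht m n => exact comul_op_smul _ _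
    | ha s t hs ht => simp only [map_add, hs, ht]
  have h2 : ∀ t : BTensor A (BTensor A C C) C,
      evalRight f t = map LinearMap.id (evalRightL f) (assoc A C C C t) := by
    intro t
    induction t using BTensor.induction_on with
    | h0 => simp only [map_zero]
    | ht s z =>
      induction s using BTensor.induction_on with
      | h0 => simp only [zero_tmul, map_zero]
      | ht m n => rfl
      | ha s t hs ht => simp only [add_tmul, map_add, hs, ht]
    | ha s t hs ht => simp only [map_add, hs, ht]
  have h3 : ∀ t : BTensor A C C,
      map LinearMap.id (evalRightL f) (map LinearMap.id (comulL A C) t) =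
        map LinearMap.id (actL f) t := by
    intro t
    induction t using BTensor.induction_on with
    | h0 => simp only [map_zero]
    | ht m n => rfl
    | ha s t hs ht => simp only [map_add, hs, ht]
  exact (h1 _).trans ((h2 _).trans ((congrArg _ (Coring.coassoc c)).trans (h3 _)))

theorem actR_comp (f g : C →ₗ[Aᵐᵒᵖ] A) (c : C) :
    actR (g.comp (actR f)) c = actR g (actR f c) := by
  have h : ∀ t : BTensor A C C, evalLeft (g.comp (actR f)) t =
      evalLeft g (map (actR f) LinearMap.id t) := by
    intro t
    induction t using BTensor.induction_on with
    | h0 => simp only [map_zero]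
    | ht m n => rfl
    | ha s t hs ht => simp only [map_add, hs, ht]
  exact (h _).trans (congrArg _ (comul_actR f c).symm)

theorem actL_comp (f g : C →ₗ[A] A) (c : C) :
    actL (f.comp (actL g)) c = actL f (actL g c) := by
  have h : ∀ t : BTensor A C C, evalRight (f.comp (actL g)) t =
      evalRight f (map LinearMap.id (actL g) t) := by
    intro t
    induction t using BTensor.induction_on with
    | h0 => simp only [map_zero]
    | ht m n => rfl
    | ha s t hs ht => simp only [map_add, hs, ht]
  exact (h _).trans (congrArg _ (comul_actL g c).symm)

theorem counit_actR (f : C →ₗ[Aᵐᵒᵖ] A) (c : C) : counitR A C (actR f c) = f c := by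
  have h : ∀ t : BTensor A C C, counitR A C (evalLeft f t) =
      f (evalRight (counitL A C) t) := by
    intro t
    induction t using BTensor.induction_on with
    | h0 => simp only [map_zero]
    | ht m n =>
      exact (counit_smul _ _).trans (LinearMap.map_smul f (op (counit n)) m).symm
    | ha s t hs ht => simp only [map_add, hs, ht]
  exact (h _).trans (congrArg f (Coring.counit_right c))

theorem counit_actL (f : C →ₗ[A] A) (c : C) : counitL A C (actL f c) = f c := by
  have h : ∀ t : BTensor A C C, counitL A C (evalRight f t) =
      f (evalLeft (counitR A C) t) := by
    intro t
    induction t using BTensor.induction_on with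
    | h0 => simp only [map_zero]
    | ht m n =>
      exact (counit_op_smul _ _).trans (LinearMap.map_smul f (counit m) n).symm
    | ha s t hs ht => simp only [map_add, hs, ht]
  exact (h _).trans (congrArg f (Coring.counit_left c))

theorem actR_counit (c : C) : actR (counitR A C) c = c :=
  Coring.counit_left (A := A) c

theorem actL_counit (c : C) : actL (counitL A C) c = c :=
  Coring.counit_right (A := A) c

theorem actR_add (f g : C →ₗ[Aᵐᵒᵖ] A) (c : C) : actR (f + g) c = actR f c + actR g c := by
  have h : ∀ t : BTensor A C C, evalLeft (N := C) (f + g) t = evalLeft f t + evalLeft g t := by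
    intro t
    induction t using BTensor.induction_on with
    | h0 => simp only [map_zero, add_zero]
    | ht m n => exact add_smul _ _ _
    | ha s t hs ht => rw [map_add, map_add, map_add, hs, ht]; abel
  exact h _

theorem actL_add (f g : C →ₗ[A] A) (c : C) : actL (f + g) c = actL f c + actL g c := by
  have h : ∀ t : BTensor A C C, evalRight (M := C) (f + g) t =
      evalRight f t + evalRight g t := by
    intro t
    induction t using BTensor.induction_on with
    | h0 => simp only [map_zero, add_zero]
    | ht m n => exact add_smul (op (f n)) (op (g n)) m
    | ha s t hs ht => rw [map_add, map_add, map_add, hs, ht]; abel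
  exact h _

theorem actR_zero (c : C) : actR (0 : C →ₗ[Aᵐᵒᵖ] A) c = 0 := by
  have h := actR_add (0 : C →ₗ[Aᵐᵒᵖ] A) 0 c
  rw [add_zero] at h
  exact left_eq_add.mp h

theorem actL_zero (c : C) : actL (0 : C →ₗ[A] A) c = 0 := by
  have h := actL_add (0 : C →ₗ[A] A) 0 c
  rw [add_zero] at h
  exact left_eq_add.mp h

/-- The convolution product `(f * g)(c) = ∑ g(f(c₁) c₂)` on `C*`. -/
instance : Mul (RightDual A C) :=
  ⟨fun f g => LinearMap.comp (R₁ := Aᵐᵒᵖ) (M₁ := C) (M₂ := C) (M₃ := A) g (actR f)⟩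

instance : One (RightDual A C) := ⟨counitR A C⟩

/-- The convolution product `(f * g)(c) = ∑ f(c₁ g(c₂))` on `*C`. -/
instance : Mul (LeftDual A C) :=
  ⟨fun f g => LinearMap.comp (R₁ := A) (M₁ := C) (M₂ := C) (M₃ := A) f (actL g)⟩

instance : One (LeftDual A C) := ⟨counitL A C⟩

/-- The ring `C*` under convolution, with unity `ε`. -/
instance : Ring (RightDual A C) where
  __ := (inferInstance : AddCommGroup (RightDual A C))
  mul := (· * ·)
  one := 1
  zero_mul g := (fun g : C →ₗ[Aᵐᵒᵖ] A => LinearMap.ext fun c =>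
    (congrArg g (actR_zero c)).trans (map_zero g) :
      ∀ g : C →ₗ[Aᵐᵒᵖ] A, g.comp (actR (0 : C →ₗ[Aᵐᵒᵖ] A)) = 0) g
  mul_zero f := rfl
  left_distrib f g h := rfl
  right_distrib f g h := (fun f g h : C →ₗ[Aᵐᵒᵖ] A => LinearMap.ext fun c =>
    (congrArg h (actR_add f g c)).trans (map_add h _ _) :
      ∀ f g h : C →ₗ[Aᵐᵒᵖ] A,
        h.comp (actR (f + g)) = h.comp (actR f) + h.comp (actR g)) f g h
  mul_assoc f g h := (fun f g h : C →ₗ[Aᵐᵒᵖ] A => LinearMap.ext fun c =>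
    congrArg h (actR_comp f g c) :
      ∀ f g h : C →ₗ[Aᵐᵒᵖ] A,
        h.comp (actR (g.comp (actR f))) = (h.comp (actR g)).comp (actR f)) f g h
  one_mul f := (fun f : C →ₗ[Aᵐᵒᵖ] A => LinearMap.ext fun c => congrArg f (actR_counit c) :
      ∀ f : C →ₗ[Aᵐᵒᵖ] A, f.comp (actR (counitR A C)) = f) f
  mul_one f := (fun f : C →ₗ[Aᵐᵒᵖ] A => LinearMap.ext fun c => counit_actR f c :
      ∀ f : C →ₗ[Aᵐᵒᵖ] A, (counitR A C).comp (actR f) = f) f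

/-- The ring `*C` under convolution, with unity `ε`. -/
instance : Ring (LeftDual A C) where
  __ := (inferInstance : AddCommGroup (LeftDual A C))
  mul := (· * ·)
  one := 1
  zero_mul g := rfl
  mul_zero f := (fun f : C →ₗ[A] A => LinearMap.ext fun c =>
    (congrArg f (actL_zero c)).trans (map_zero f) :
      ∀ f : C →ₗ[A] A, f.comp (actL (0 : C →ₗ[A] A)) = 0) f
  left_distrib f g h := (fun f g h : C →ₗ[A] A => LinearMap.ext fun c =>
    (congrArg f (actL_add g h c)).trans (map_add f _ _) :
      ∀ f g h : C →ₗ[A] A,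
        f.comp (actL (g + h)) = f.comp (actL g) + f.comp (actL h)) f g h
  right_distrib f g h := rfl
  mul_assoc f g h := (fun f g h : C →ₗ[A] A => LinearMap.ext fun c =>
    (congrArg f (actL_comp g h c)).symm :
      ∀ f g h : C →ₗ[A] A,
        (f.comp (actL g)).comp (actL h) = f.comp (actL (g.comp (actL h)))) f g h
  one_mul f := (fun f : C →ₗ[A] A => LinearMap.ext fun c => counit_actL f c :
      ∀ f : C →ₗ[A] A, (counitL A C).comp (actL f) = f) f
  mul_one f := (fun f : C →ₗ[A] A => LinearMap.ext fun c => congrArg f (actL_counit c) :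
      ∀ f : C →ₗ[A] A, f.comp (actL (counitL A C)) = f) f

/-- `C` as a right `C*`-module: `op f • c` is `c ↼ f`. -/
instance : Module (RightDual A C)ᵐᵒᵖ C where
  smul f c := actR (A := A) (unop f) c
  one_smul := actR_counit (A := A)
  mul_smul f g c := actR_comp (A := A) (unop g) (unop f) c
  smul_zero f := LinearMap.map_zero (actR (A := A) (unop f))
  smul_add f := LinearMap.map_add (actR (A := A) (unop f))
  add_smul f g c := actR_add (A := A) (unop f) (unop g) c
  zero_smul := actR_zero (A := A)

/-- `C` as a left `*C`-module: `f • c` is `f ⇀ c`. -/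
instance : Module (LeftDual A C) C where
  smul f c := actL (A := A) f c
  one_smul := actL_counit (A := A)
  mul_smul f g c := actL_comp (A := A) f g c
  smul_zero f := LinearMap.map_zero (actL (A := A) f)
  smul_add f := LinearMap.map_add (actL (A := A) f)
  add_smul f g c := actL_add (A := A) f g c
  zero_smul := actL_zero (A := A)

end Dual

/-! ### Primeness notions for rings and modules -/

section Primeness

universe v

/-- A ring is prime if it is non-zero and `I J = 0` implies `I = 0` or `J = 0` for any two
two-sided ideals `I`, `J`. -/
def IsPrimeRing (T : Type*) [Ring T] : Prop :=
  Nontrivial T ∧ ∀ I J : TwoSidedIdeal T,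
    (∀ x ∈ I, ∀ y ∈ J, x * y = 0) → I = ⊥ ∨ J = ⊥

/-- A simple ring that is Artinian on both sides. -/
def IsSimpleArtinianRing (T : Type*) [Ring T] : Prop :=
  IsSimpleRing T ∧ IsArtinianRing T ∧ IsArtinianRing Tᵐᵒᵖ

/-- A quasi-Frobenius ring: Artinian and self-injective, on both sides. -/
def IsQFRing (A : Type*) [Ring A] : Prop :=
  (IsArtinianRing A ∧ IsArtinianRing Aᵐᵒᵖ) ∧ Module.Injective A A ∧ Module.Injective Aᵐᵒᵖ A

variable (T : Type*) (M : Type v) [Ring T] [AddCommGroup M] [Module T M]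

/-- `M` is prime: `M ≠ 0` and `ann(K) = ann(M)` for every non-zero submodule `K`. -/
def IsPrimeModule : Prop :=
  Nontrivial M ∧ ∀ K : Submodule T M, K ≠ ⊥ →
    Module.annihilator T K = Module.annihilator T M

/-- `M` is diprime: `M ≠ 0` and `ann(K) = ann(M)` or `ann(M / K) = ann(M)` for every submodule
`0 ≠ K ≠ M`. -/
def IsDiprimeModule : Prop :=
  Nontrivial M ∧ ∀ K : Submodule T M, K ≠ ⊥ → K ≠ ⊤ →
    Module.annihilator T K = Module.annihilator T M ∨
      Module.annihilator T (M ⧸ K) = Module.annihilator T M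

/-- `M` lies in `σ[K]`: it is isomorphic to a submodule of a quotient of a direct sum `K^(ι)`
of copies of `K`. -/
def IsSubgeneratedBy (T : Type*) (K M : Type v) [Ring T] [AddCommGroup K] [Module T K]
    [AddCommGroup M] [Module T M] : Prop :=
  ∃ (ι : Type v) (N : Submodule T (ι →₀ K)) (g : M →ₗ[T] (ι →₀ K) ⧸ N), Function.Injective g

/-- `M` is strongly prime: `M ≠ 0` and `M` lies in `σ[K]` for every non-zero submodule `K`. -/
def IsStronglyPrimeModule : Prop :=
  Nontrivial M ∧ ∀ K : Submodule T M, K ≠ ⊥ → IsSubgeneratedBy T K M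

end Primeness

/-! ### Coideals, full coprimeness and simplicity of a coring -/

section Coideals

variable {A C : Type*} [Ring A] [AddCommGroup C] [Module A C] [Module Aᵐᵒᵖ C]
  [SMulCommClass A Aᵐᵒᵖ C] [Coring A C]

/-- A right coideal: a right `A`-submodule `K` of `C` with `Δ(K) ⊆ K ⊗_A C`, meaning the image
of `K ⊗_A C` in `C ⊗_A C`.  For `C` flat as a left `A`-module these are the right
subcomodules of `C`. -/
def IsRightCoideal (K : Submodule Aᵐᵒᵖ C) : Prop :=
  ∀ c ∈ K, (comul c : BTensor A C C) ∈ (map (A := A) (N := C) K.subtype LinearMap.id).range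

/-- A left coideal: a left `A`-submodule `K` of `C` with `Δ(K) ⊆ C ⊗_A K`. -/
def IsLeftCoideal (K : Submodule A C) : Prop :=
  ∀ c ∈ K, (comul c : BTensor A C C) ∈ (map (A := A) (M := C) LinearMap.id K.subtype).range

/-- `f` is an endomorphism of `C` as a right `C`-comodule. -/
def IsRightColinear (f : C →ₗ[Aᵐᵒᵖ] C) : Prop :=
  ∀ c, (comul (f c) : BTensor A C C) = map f LinearMap.id (comul c)

/-- `f` is an endomorphism of `C` as a left `C`-comodule. -/
def IsLeftColinear (f : C →ₗ[A] C) : Prop :=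
  ∀ c, (comul (f c) : BTensor A C C) = map LinearMap.id f (comul c)

/-- A right coideal that is stable under all right colinear endomorphisms of `C`. -/
def IsFullyInvariantRightCoideal (K : Submodule Aᵐᵒᵖ C) : Prop :=
  IsRightCoideal K ∧ ∀ f : C →ₗ[Aᵐᵒᵖ] C, IsRightColinear f → ∀ c ∈ K, f c ∈ K

/-- A left coideal that is stable under all left colinear endomorphisms of `C`. -/
def IsFullyInvariantLeftCoideal (K : Submodule A C) : Prop :=
  IsLeftCoideal K ∧ ∀ f : C →ₗ[A] C, IsLeftColinear f → ∀ c ∈ K, f c ∈ K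

/-- The internal coproduct `(X : Y)` in the category of right `C`-comodules. -/
def rightInternalCoproduct (X Y : Submodule Aᵐᵒᵖ C) : Submodule Aᵐᵒᵖ C :=
  ⨅ f : {f : C →ₗ[Aᵐᵒᵖ] C // IsRightColinear f ∧ ∀ x ∈ X, f x = 0}, Y.comap f.1

/-- The internal coproduct `(X : Y)` in the category of left `C`-comodules. -/
def leftInternalCoproduct (X Y : Submodule A C) : Submodule A C :=
  ⨅ f : {f : C →ₗ[A] C // IsLeftColinear f ∧ ∀ x ∈ X, f x = 0}, Y.comap f.1

variable (A C)

/-- `Cʳ`, that is `C` as a right `C`-comodule, is fully coprime. -/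
def IsRightFullyCoprime : Prop :=
  Nontrivial C ∧ ∀ X Y : Submodule Aᵐᵒᵖ C,
    IsFullyInvariantRightCoideal X → IsFullyInvariantRightCoideal Y →
      ⊤ ≤ rightInternalCoproduct X Y → ⊤ ≤ X ∨ ⊤ ≤ Y

/-- `Cˡ`, that is `C` as a left `C`-comodule, is fully coprime. -/
def IsLeftFullyCoprime : Prop :=
  Nontrivial C ∧ ∀ X Y : Submodule A C,
    IsFullyInvariantLeftCoideal X → IsFullyInvariantLeftCoideal Y →
      ⊤ ≤ leftInternalCoproduct X Y → ⊤ ≤ X ∨ ⊤ ≤ Y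

/-- `C` is simple: `C ≠ 0` has no non-trivial `(*C, C*)`-subbimodules. -/
def IsSimpleCoring : Prop :=
  Nontrivial C ∧ ∀ K : AddSubgroup C,
    (∀ (f : LeftDual A C), ∀ c ∈ K, f • c ∈ K) →
      (∀ (g : RightDual A C), ∀ c ∈ K, op g • c ∈ K) → K = ⊥ ∨ K = ⊤

end Coideals

/-! ### Prime Artinian rings -/

/-! Everything takes place in the bimodule `C` over `*C` and `C*`. It is faithful on both sides,
because the counit recovers a form from its action. Colinear endomorphisms of `C` are exactly the
actions of one dual ring, and projectivity makes coideals the submodules stable under the other.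
Fully invariant coideals, right or left, are therefore just the subbimodules. Simplicity of the
bimodule does not distinguish the sides, so it links the two one-sided lists of conditions.

On one side the argument is module theory (`primeness_tfae_of_faithful_bimodule`). A prime Artinian
ring is simple. Over a simple Artinian ring every non-zero submodule `K` is faithful, and the chain
condition embeds the ring in a finite power of `K`, so `K` subgenerates every module. Strongly prime
implies prime, which implies diprime, and a faithful diprime module forces its ring to be prime.

Subbimodules enter through two consequences of the QF hypothesis. Proper subbimodules have non-zero
annihilator, since `A` is an injective cogenerator (`annihilator_ne_bot_right`,
`annihilator_ne_bot_left`). Ideals of the acting ring are determined by the elements of `C` they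
kill, since `A` is injective and the ideals are finitely generated
(`mem_ideal_of_forall_smul_eq_zero_right` and its left version). -/

/-- The radical `J` is nilpotent. If `J ≠ 0` and `k + 1` is the least exponent with `J ^ (k + 1) =
0`, the non-zero ideals `J ^ k` and `J` have product zero. -/
theorem IsPrimeRing.jacobson_eq_bot {T : Type*} [Ring T] [IsArtinianRing T] (h : IsPrimeRing T) :
    Ring.jacobson T = ⊥ := by
  have hnil : IsNilpotent (Ring.jacobson T) := by
    rw [← Ideal.jacobson_bot]
    exact IsArtinianRing.isNilpotent_jacobson_bot
  by_contra hne
  classical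
  have hex : ∃ n, Ring.jacobson T ^ n = ⊥ := hnil
  set n := Nat.find hex
  have hspec : Ring.jacobson T ^ n = ⊥ := Nat.find_spec hex
  have : Nontrivial T := h.1
  obtain ⟨k, hk⟩ : ∃ k, n = k + 1 := by
    refine Nat.exists_eq_succ_of_ne_zero fun h0 => ?_
    rw [h0, Submodule.pow_zero, Ideal.one_eq_top] at hspec
    exact top_ne_bot hspec
  have hk0 : Ring.jacobson T ^ k ≠ ⊥ := Nat.find_min hex (by omega)
  have key : ∀ x ∈ (Ring.jacobson T ^ k).toTwoSided, ∀ y ∈ (Ring.jacobson T).toTwoSided,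
      x * y = 0 := by
    intro x hx y hy
    rw [Ideal.mem_toTwoSided] at hx hy
    have hxy := Ideal.mul_mem_mul hx hy
    rwa [← Submodule.pow_succ, ← hk, hspec, Ideal.mem_bot] at hxy
  rcases h.2 _ _ key with h1 | h1
  · apply hk0
    rw [← Ideal.asIdeal_toTwoSided (Ring.jacobson T ^ k), h1, TwoSidedIdeal.bot_asIdeal]
  · apply hne
    rw [← Ideal.asIdeal_toTwoSided (Ring.jacobson T), h1, TwoSidedIdeal.bot_asIdeal]

/-- By semisimplicity a non-zero ideal `I` has a complementary left ideal `L`. Then `I L ⊆ I ∩ L =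
0`, so `L` lies in the right annihilator of `I`, which primeness makes zero. -/
theorem IsPrimeRing.isSimpleRing {T : Type*} [Ring T] [IsArtinianRing T] (h : IsPrimeRing T) :
    IsSimpleRing T := by
  have : Nontrivial T := h.1
  have hss : IsSemisimpleRing T := IsArtinianRing.isSemisimpleRing_iff_jacobson.2 h.jacobson_eq_bot
  refine IsSimpleRing.of_eq_bot_or_eq_top fun I => ?_
  rw [or_iff_not_imp_left]
  intro hI
  obtain ⟨L, hL⟩ := exists_isCompl I.asIdeal
  -- The right annihilator of `I`; it is two-sided because `I` is also a right ideal.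
  let J : TwoSidedIdeal T := TwoSidedIdeal.mk' {x | ∀ y ∈ I, y * x = 0}
    (by simp) (fun hx hy z hz => by rw [mul_add, hx z hz, hy z hz, add_zero])
    (fun hx z hz => by rw [mul_neg, hx z hz, neg_zero])
    (fun {x y} hy z hz => by
      rw [← mul_assoc]; exact hy _ (I.mul_mem_right _ _ hz))
    (fun {x y} hx z hz => by rw [← mul_assoc, hx z hz, zero_mul])
  have hJ : J = ⊥ := (h.2 I J fun x hx y hy => by
    rw [TwoSidedIdeal.mem_mk'] at hy
    exact hy x hx).resolve_left hI
  have hLb : L = ⊥ := by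
    rw [eq_bot_iff]
    intro x hx
    have hxJ : x ∈ J := by
      rw [TwoSidedIdeal.mem_mk']
      intro y hy
      have : y * x ∈ I.asIdeal ⊓ L :=
        ⟨TwoSidedIdeal.mem_asIdeal.2 (I.mul_mem_right _ _ hy), L.mul_mem_left y hx⟩
      rwa [hL.inf_eq_bot, Ideal.mem_bot] at this
    rw [hJ] at hxJ
    exact hxJ
  have htop := hL.sup_eq_top
  rw [hLb, sup_bot_eq] at htop
  rw [← I.one_mem_iff, ← TwoSidedIdeal.mem_asIdeal, htop]
  trivial

theorem IsPrimeRing.isSimpleArtinianRing {T : Type*} [Ring T] [IsArtinianRing T]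
    (h : IsPrimeRing T) : IsSimpleArtinianRing T := by
  have := h.isSimpleRing
  have hss : IsSemisimpleRing T := IsSimpleRing.isSemisimpleRing_iff_isArtinianRing.2 ‹_›
  have hop : IsSemisimpleRing Tᵐᵒᵖ := isSemisimpleRing_mulOpposite_iff.2 hss
  exact ⟨this, ‹_›, inferInstance⟩

theorem isPrimeRing_mulOpposite_of_isPrimeRing {T : Type*} [Ring T] (h : IsPrimeRing T) :
    IsPrimeRing Tᵐᵒᵖ := by
  have : Nontrivial T := h.1
  refine ⟨inferInstance, fun I J hIJ => ?_⟩
  -- Passing to the opposite ring reverses products, so the two ideals change places.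
  have := h.2 J.unop I.unop fun x hx y hy =>
    op_injective (hIJ _ (TwoSidedIdeal.mem_unop_iff.1 hy) _ (TwoSidedIdeal.mem_unop_iff.1 hx))
  have hb : ∀ K : TwoSidedIdeal Tᵐᵒᵖ, K.unop = ⊥ → K = ⊥ := fun K hK =>
    (map_eq_bot_iff TwoSidedIdeal.opOrderIso.symm).1 hK
  exact this.symm.imp (hb I) (hb J)

theorem isPrimeRing_of_isPrimeRing_mulOpposite {T : Type*} [Ring T] (h : IsPrimeRing Tᵐᵒᵖ) :
    IsPrimeRing T := by
  have : Nontrivial Tᵐᵒᵖ := h.1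
  refine ⟨unop_injective.nontrivial, fun I J hIJ => ?_⟩
  have := h.2 J.op I.op fun x hx y hy =>
    unop_injective (hIJ _ (TwoSidedIdeal.mem_op_iff.1 hy) _ (TwoSidedIdeal.mem_op_iff.1 hx))
  have hb : ∀ K : TwoSidedIdeal T, K.op = ⊥ → K = ⊥ := fun K hK =>
    (map_eq_bot_iff TwoSidedIdeal.opOrderIso).1 hK
  exact this.symm.imp (hb I) (hb J)

theorem isPrimeRing_mulOpposite_iff {T : Type*} [Ring T] : IsPrimeRing Tᵐᵒᵖ ↔ IsPrimeRing T :=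
  ⟨isPrimeRing_of_isPrimeRing_mulOpposite, isPrimeRing_mulOpposite_of_isPrimeRing⟩

theorem IsSimpleArtinianRing.isPrimeRing {T : Type*} [Ring T] (h : IsSimpleArtinianRing T) :
    IsPrimeRing T := by
  have := h.1
  refine ⟨inferInstance, fun I J hIJ => ?_⟩
  by_contra! hne
  have h1 := hIJ 1 (IsSimpleRing.one_mem_of_ne_bot I hne.1) 1
    (IsSimpleRing.one_mem_of_ne_bot J hne.2)
  exact one_ne_zero ((mul_one (1 : T)).symm.trans h1)

theorem IsSimpleRing.ideal_eq_bot_or_eq_top {T : Type*} [Ring T] [IsSimpleRing T] (I : Ideal T)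
    [I.IsTwoSided] : I = ⊥ ∨ I = ⊤ := by
  rcases eq_bot_or_eq_top I.toTwoSided with h | h
  · left; rw [← Ideal.asIdeal_toTwoSided I, h, TwoSidedIdeal.bot_asIdeal]
  · right; rw [← Ideal.asIdeal_toTwoSided I, h, TwoSidedIdeal.top_asIdeal]

/-! ### Primeness of a faithful bimodule over an Artinian ring -/

section Bimodule

universe v

variable {T : Type*} {M : Type v} [Ring T] [AddCommGroup M] [Module T M]

/-- The elements of `M` that are killed by the two-sided ideal `I`. -/
def TwoSidedIdeal.torsion (M : Type v) [AddCommGroup M] [Module T M] (I : TwoSidedIdeal T) :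
    Submodule T M where
  carrier := {m | ∀ i ∈ I, i • m = 0}
  zero_mem' := by simp
  add_mem' hx hy i hi := by rw [smul_add, hx i hi, hy i hi, add_zero]
  smul_mem' t m hm i hi := by
    rw [← mul_smul]; exact hm _ (I.mul_mem_right _ _ hi)

theorem TwoSidedIdeal.mem_torsion {I : TwoSidedIdeal T} {m : M} :
    m ∈ I.torsion M ↔ ∀ i ∈ I, i • m = 0 := Iff.rfl

theorem TwoSidedIdeal.eq_bot_of_forall_smul [FaithfulSMul T M] {I : TwoSidedIdeal T}
    (h : ∀ i ∈ I, ∀ m : M, i • m = 0) : I = ⊥ := by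
  rw [eq_bot_iff]
  intro i hi
  exact FaithfulSMul.eq_of_smul_eq_smul (α := M) fun m => by rw [h i hi m, zero_smul]

theorem TwoSidedIdeal.eq_bot_of_torsion_eq_top [FaithfulSMul T M] {I : TwoSidedIdeal T}
    (h : I.torsion M = ⊤) : I = ⊥ :=
  eq_bot_of_forall_smul (M := M) fun i hi m =>
    mem_torsion.1 (h ▸ Submodule.mem_top : m ∈ I.torsion M) i hi

/-- Choose a finite set whose annihilator is minimal. Adjoining any `m` cannot shrink this
annihilator, so it kills all of `M` and is zero by faithfulness. -/
theorem exists_finset_forall_smul_eq_zero [IsArtinianRing T] [FaithfulSMul T M] :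
    ∃ s : Finset M, ∀ t : T, (∀ x ∈ s, t • x = 0) → t = 0 := by
  classical
  let F : Finset M → Ideal T := fun s => ⨅ x ∈ s, LinearMap.ker (LinearMap.toSpanSingleton T M x)
  have hF : ∀ s t, t ∈ F s ↔ ∀ x ∈ s, t • x = 0 := by
    intro s t
    simp [F, Submodule.mem_iInf]
  obtain ⟨I, ⟨s, rfl⟩, hs⟩ := IsArtinian.set_has_minimal (Set.range F) (Set.range_nonempty F)
  refine ⟨s, fun t ht => FaithfulSMul.eq_of_smul_eq_smul (α := M) fun m => ?_⟩
  rw [zero_smul]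
  by_contra hne
  refine hs (F (insert m s)) ⟨_, rfl⟩ (lt_of_le_of_ne ?_ ?_)
  · intro u hu
    rw [hF] at hu ⊢
    exact fun x hx => hu x (Finset.mem_insert_of_mem hx)
  · intro heq
    have : t ∈ F (insert m s) := heq ▸ (hF s t).2 ht
    exact hne ((hF _ t).1 this m (Finset.mem_insert_self m s))

/-- A faithful module over an Artinian ring subgenerates every module. -/
theorem isSubgeneratedBy_of_faithful [IsArtinianRing T] {K : Type v} [AddCommGroup K] [Module T K]
    [FaithfulSMul T K] : IsSubgeneratedBy T K M := by
  classical
  obtain ⟨s, hs⟩ := exists_finset_forall_smul_eq_zero (T := T) (M := K)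
  -- A finite set with zero annihilator embeds `T` in a finite power of `K`, hence the free module
  -- on `M` in `K^(M × s)`. Quotienting both sides by the relations of `M` keeps the map injective.
  let e : T →ₗ[T] (s →₀ K) := (Finsupp.linearEquivFunOnFinite T K s).symm.toLinearMap ∘ₗ
    LinearMap.pi fun x : s => LinearMap.toSpanSingleton T K x
  have he : Function.Injective e := by
    rw [injective_iff_map_eq_zero]
    intro t ht
    refine hs t fun x hx => ?_
    exact DFunLike.congr_fun ht ⟨x, hx⟩
  let E : (M →₀ T) →ₗ[T] (M × s →₀ K) :=
    (Finsupp.curryLinearEquiv T).symm.toLinearMap ∘ₗ Finsupp.mapRange.linearMap e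
  have hE : Function.Injective E :=
    (Finsupp.curryLinearEquiv T).symm.injective.comp (Finsupp.mapRange_injective e (map_zero e) he)
  let p : (M →₀ T) →ₗ[T] M := Finsupp.linearCombination T id
  have hp : Function.Surjective p := Finsupp.linearCombination_id_surjective T M
  let N : Submodule T (M × s →₀ K) := (LinearMap.ker p).map E
  let φ : ((M →₀ T) ⧸ LinearMap.ker p) →ₗ[T] (M × s →₀ K) ⧸ N :=
    Submodule.mapQ _ N E (Submodule.le_comap_map _ _)
  have hφ : Function.Injective φ := by
    rw [← LinearMap.ker_eq_bot, Submodule.ker_mapQ, Submodule.comap_map_eq_of_injective hE,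
      Submodule.mkQ_map_self]
  exact ⟨M × s, N, φ ∘ₗ (p.quotKerEquivOfSurjective hp).symm.toLinearMap,
    hφ.comp (LinearEquiv.injective _)⟩

theorem IsSubgeneratedBy.annihilator_le {K : Type v} [AddCommGroup K] [Module T K]
    (h : IsSubgeneratedBy T K M) : Module.annihilator T K ≤ Module.annihilator T M := by
  obtain ⟨ι, N, g, hg⟩ := h
  intro t ht
  rw [Module.mem_annihilator] at ht ⊢
  intro m
  apply hg
  rw [map_smul, map_zero]
  obtain ⟨x, hx⟩ := N.mkQ_surjective (g m)
  rw [← hx, ← map_smul]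
  have : t • x = 0 := by ext i; exact ht _
  rw [this, map_zero]

theorem IsStronglyPrimeModule.isPrimeModule (h : IsStronglyPrimeModule T M) :
    IsPrimeModule T M :=
  ⟨h.1, fun K hK => le_antisymm (h.2 K hK).annihilator_le
    (K.subtype.annihilator_le_of_injective K.injective_subtype)⟩

theorem IsPrimeModule.isDiprimeModule (h : IsPrimeModule T M) : IsDiprimeModule T M :=
  ⟨h.1, fun K hK _ => Or.inl (h.2 K hK)⟩

/-- If `I J = 0`, then `J M` lies in the `I`-torsion `K` of `M`. Thus `I` kills `K` and `J` kills `M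
/ K`, and diprimeness makes one of these two modules faithful. The cases `K = 0` and `K = M` are
handled apart. -/
theorem IsDiprimeModule.isPrimeRing [FaithfulSMul T M] (h : IsDiprimeModule T M) :
    IsPrimeRing T := by
  have : Nontrivial M := h.1
  refine ⟨Module.nontrivial T M, fun I J hIJ => ?_⟩
  have hann : ∀ t, t ∈ Module.annihilator T M → t = 0 := fun t ht =>
    FaithfulSMul.eq_of_smul_eq_smul (α := M) fun m => by
      rw [Module.mem_annihilator.1 ht m, zero_smul]
  have hJ : ∀ j ∈ J, ∀ m : M, j • m ∈ I.torsion M := fun j hj m i hi => by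
    rw [← mul_smul, hIJ i hi j hj, zero_smul]
  by_cases hbot : I.torsion M = ⊥
  · right
    refine TwoSidedIdeal.eq_bot_of_forall_smul (M := M) fun j hj m => ?_
    simpa [hbot] using hJ j hj m
  by_cases htop : I.torsion M = ⊤
  · exact Or.inl (TwoSidedIdeal.eq_bot_of_torsion_eq_top htop)
  rcases h.2 _ hbot htop with h1 | h1
  · left
    rw [eq_bot_iff]
    intro i hi
    refine hann i ?_
    rw [← h1, Module.mem_annihilator]
    exact fun m => Subtype.ext (m.2 i hi)
  · right
    rw [eq_bot_iff]
    intro j hj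
    refine hann j ?_
    rw [← h1, Module.mem_annihilator]
    intro m
    obtain ⟨m, rfl⟩ := (I.torsion M).mkQ_surjective m
    rw [← map_smul]
    exact (Submodule.Quotient.mk_eq_zero _).2 (hJ j hj m)

theorem IsSimpleRing.annihilator_eq_bot [IsSimpleRing T] [Nontrivial M] :
    Module.annihilator T M = ⊥ :=
  (IsSimpleRing.ideal_eq_bot_or_eq_top _).resolve_right fun h => by
    obtain ⟨m, hm⟩ := exists_ne (0 : M)
    have h1 : (1 : T) ∈ Module.annihilator T M := h ▸ Submodule.mem_top
    exact hm (by simpa using Module.mem_annihilator.1 h1 m)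

theorem IsSimpleArtinianRing.isStronglyPrimeModule [Nontrivial M] (h : IsSimpleArtinianRing T) :
    IsStronglyPrimeModule T M := by
  have := h.1
  have := h.2.1
  refine ⟨inferInstance, fun K hK => ?_⟩
  have : Nontrivial K := Submodule.nontrivial_iff_ne_bot.2 hK
  have : FaithfulSMul T K := Module.annihilator_eq_bot.1 IsSimpleRing.annihilator_eq_bot
  exact isSubgeneratedBy_of_faithful

/-- For a faithful module `M` over an Artinian ring `T`, with a commuting action of `S`, such that
proper subbimodules are not faithful and left ideals of `T` satisfy the double annihilator
condition, the primeness conditions on `T` and `M` are equivalent to simplicity of the bimodule. -/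
theorem primeness_tfae_of_faithful_bimodule (T S : Type*) (M : Type v) [Ring T] [Ring S]
    [AddCommGroup M] [Module T M] [Module S M] [SMulCommClass S T M] [Nontrivial M]
    [FaithfulSMul T M] [IsArtinianRing T]
    (hann : ∀ K : Submodule T M, (∀ s : S, ∀ k ∈ K, s • k ∈ K) → K ≠ ⊤ →
      Module.annihilator T K ≠ ⊥)
    (hdouble : ∀ (I : Ideal T) (t : T),
      (∀ m : M, (∀ i ∈ I, i • m = 0) → t • m = 0) → t ∈ I) :
    List.TFAE [
      IsPrimeRing T,
      IsDiprimeModule T M,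
      IsPrimeModule T M,
      IsSimpleArtinianRing T,
      IsStronglyPrimeModule T M,
      ∀ X Y : Submodule T M, (∀ s : S, ∀ k ∈ X, s • k ∈ X) → (∀ s : S, ∀ k ∈ Y, s • k ∈ Y) →
        (∀ t : T, (∀ x ∈ X, t • x = 0) → ∀ m, t • m ∈ Y) → X = ⊤ ∨ Y = ⊤,
      ∀ K : Submodule T M, (∀ s : S, ∀ k ∈ K, s • k ∈ K) → K = ⊥ ∨ K = ⊤] := by
  have htor : ∀ (I : TwoSidedIdeal T) (s : S), ∀ m ∈ I.torsion M, s • m ∈ I.torsion M :=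
    fun I s m hm i hi => by rw [← smul_comm, hm i hi, smul_zero]
  tfae_have 1 → 4 := IsPrimeRing.isSimpleArtinianRing
  tfae_have 4 → 5 := IsSimpleArtinianRing.isStronglyPrimeModule
  tfae_have 5 → 3 := IsStronglyPrimeModule.isPrimeModule
  tfae_have 3 → 2 := IsPrimeModule.isDiprimeModule
  tfae_have 2 → 1 := IsDiprimeModule.isPrimeRing
  tfae_have 4 → 7 := by
    intro h K hK
    have := h.1
    by_contra! hne
    have : Nontrivial K := Submodule.nontrivial_iff_ne_bot.2 hne.1
    exact hann K hK hne.2 IsSimpleRing.annihilator_eq_bot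
  tfae_have 7 → 6 := by
    intro h X Y hX hY hXY
    -- If `X = 0`, then `t = 1` is admissible and gives `M ⊆ Y`.
    refine (h X hX).symm.imp_right fun hbot => ?_
    rw [eq_top_iff]
    intro m _
    have := hXY 1 (fun x hx => by rw [hbot, Submodule.mem_bot] at hx; rw [hx, smul_zero]) m
    rwa [one_smul] at this
  tfae_have 6 → 1 := by
    intro h
    refine ⟨Module.nontrivial T M, fun I J hIJ => ?_⟩
    -- Whatever kills the `J`-torsion lies in `J` by the double annihilator condition. It then maps
    -- `M` into the `I`-torsion, because `I J = 0`.
    refine (h (J.torsion M) (I.torsion M) (htor J) (htor I) fun t ht m i hi => ?_).symm.imp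
      TwoSidedIdeal.eq_bot_of_torsion_eq_top TwoSidedIdeal.eq_bot_of_torsion_eq_top
    have htJ : t ∈ J := TwoSidedIdeal.mem_asIdeal.1 (hdouble J.asIdeal t fun m hm =>
      ht m fun j hj => hm j (TwoSidedIdeal.mem_asIdeal.2 hj))
    rw [← mul_smul, hIJ i hi t htJ, zero_smul]
  tfae_finish

end Bimodule

/-! ### Injective modules and quasi-Frobenius rings -/

section Injective

variable {B Q M N : Type*} [Ring B] [AddCommGroup Q] [Module B Q] [AddCommGroup M] [Module B M]
  [AddCommGroup N] [Module B N]

/-- Extension along a map that need not be injective: `g` factors through `M / ker φ`, which embeds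
in `N`. -/
theorem Module.Baer.exists_comp_eq (hQ : Module.Baer B Q) (φ : M →ₗ[B] N) (g : M →ₗ[B] Q)
    (h : ∀ m, φ m = 0 → g m = 0) : ∃ k : N →ₗ[B] Q, ∀ m, k (φ m) = g m := by
  let φ' : (M ⧸ LinearMap.ker φ) →ₗ[B] N := (LinearMap.ker φ).liftQ φ le_rfl
  have hφ' : Function.Injective φ' := by
    rw [← LinearMap.ker_eq_bot]
    exact Submodule.ker_liftQ_eq_bot' _ _ rfl
  obtain ⟨k, hk⟩ := hQ.extension_property φ' hφ'
    ((LinearMap.ker φ).liftQ g fun m hm => h m hm)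
  exact ⟨k, fun m => LinearMap.congr_fun hk ((LinearMap.ker φ).mkQ m)⟩

/-- A map to an injective module that vanishes on the common kernel of finitely many maps is a
combination of these maps. -/
theorem Module.Baer.exists_eq_sum_comp (hQ : Module.Baer B Q) {ι : Type*} [Fintype ι]
    (φ : ι → M →ₗ[B] N) (g : M →ₗ[B] Q) (h : ∀ m, (∀ i, φ i m = 0) → g m = 0) :
    ∃ k : ι → N →ₗ[B] Q, ∀ m, g m = ∑ i, k i (φ i m) := by
  classical
  obtain ⟨k, hk⟩ := hQ.exists_comp_eq (LinearMap.pi φ) g fun m hm => h m fun i => congrFun hm i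
  refine ⟨fun i => k ∘ₗ LinearMap.single B (fun _ => N) i, fun m => ?_⟩
  rw [← hk m]
  conv_lhs => rw [← Finset.univ_sum_single (LinearMap.pi φ m), map_sum]
  rfl

/-- An injective module that receives a non-zero map from every non-zero cyclic module separates
points from submodules. -/
theorem Module.Baer.exists_linearMap_apply_ne_zero (hQ : Module.Baer B Q)
    (hcog : ∀ I : Ideal B, I ≠ ⊤ → ∃ q : Q, q ≠ 0 ∧ ∀ b ∈ I, b • q = 0)
    {K : Submodule B M} {c : M} (hc : c ∉ K) :
    ∃ g : M →ₗ[B] Q, (∀ k ∈ K, g k = 0) ∧ g c ≠ 0 := by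
  -- The class of `c` generates a non-zero cyclic submodule `B / ker φ`. Sending the class of `c` to
  -- `q` defines a map on it, which injectivity extends to `M / K`.
  let φ : B →ₗ[B] M ⧸ K := LinearMap.toSpanSingleton B _ (K.mkQ c)
  obtain ⟨q, hq, hIq⟩ := hcog (LinearMap.ker φ) (by
    intro h
    have h1 : φ 1 = 0 := LinearMap.mem_ker.1 (h ▸ Submodule.mem_top)
    refine hc ((Submodule.Quotient.mk_eq_zero K).1 ?_)
    simpa [φ] using h1)
  obtain ⟨k, hk⟩ := hQ.exists_comp_eq φ (LinearMap.toSpanSingleton B Q q) fun b hb => hIq b hb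
  refine ⟨k ∘ₗ K.mkQ, fun x hx => ?_, ?_⟩
  · have : K.mkQ x = 0 := (Submodule.Quotient.mk_eq_zero K).2 hx
    rw [LinearMap.comp_apply, this, map_zero]
  · have := hk 1
    simp only [φ, LinearMap.toSpanSingleton_apply, one_smul] at this
    rw [LinearMap.comp_apply, this]
    exact hq

end Injective

section QF

variable {A : Type*} [Ring A]

theorem IsQFRing.baer_left (hA : IsQFRing A) : Module.Baer A A :=
  Module.Baer.of_injective hA.2.1

theorem IsQFRing.baer_right (hA : IsQFRing A) : Module.Baer Aᵐᵒᵖ A :=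
  Module.Baer.of_injective hA.2.2

/-- Left multiplications by finitely many generators of `I` are right linear. If no non-zero element
were killed by `I`, their common kernel would be zero, and right self-injectivity would write the
identity as `∑ kₓ ∘ φₓ`. At `1` this gives `1 = ∑ kₓ(1) x ∈ I`. -/
theorem IsQFRing.exists_ne_zero_left (hA : IsQFRing A) (I : Ideal A) (hI : I ≠ ⊤) :
    ∃ q : A, q ≠ 0 ∧ ∀ b ∈ I, b • q = 0 := by
  classical
  have := hA.1.1
  obtain ⟨s, rfl⟩ := (isNoetherianRing_iff_ideal_fg A).1 inferInstance I
  by_contra! hno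
  let φ : s → A →ₗ[Aᵐᵒᵖ] A := fun x => Module.toModuleEnd Aᵐᵒᵖ (S := A) A (x : A)
  obtain ⟨k, hk⟩ := hA.baer_right.exists_eq_sum_comp φ LinearMap.id (by
    intro a ha
    by_contra hne
    obtain ⟨b, hb, hba⟩ := hno a hne
    have hle : Ideal.span (s : Set A) ≤ LinearMap.ker (LinearMap.toSpanSingleton A A a) :=
      Ideal.span_le.2 fun x hx => ha ⟨x, hx⟩
    exact hba (hle hb))
  refine hI ((Ideal.eq_top_iff_one _).2 ?_)
  rw [show (1 : A) = _ from hk 1]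
  refine Ideal.sum_mem _ fun x _ => ?_
  -- Reading `x` as `1 · x` lets right linearity turn `kₓ(x)` into `kₓ(1) x`.
  have h1 : φ x 1 = op (x : A) • (1 : A) := (mul_one (x : A)).trans (one_mul (x : A)).symm
  rw [h1, map_smul]
  exact Ideal.mul_mem_left _ _ (Ideal.subset_span x.2)

theorem IsQFRing.exists_ne_zero_right (hA : IsQFRing A) (I : Ideal Aᵐᵒᵖ) (hI : I ≠ ⊤) :
    ∃ q : A, q ≠ 0 ∧ ∀ b ∈ I, b • q = 0 := by
  classical
  have := hA.1.2
  obtain ⟨s, rfl⟩ := (isNoetherianRing_iff_ideal_fg Aᵐᵒᵖ).1 inferInstance I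
  by_contra! hno
  let φ : s → A →ₗ[A] A := fun x => LinearMap.toSpanSingleton A A (unop (x : Aᵐᵒᵖ))
  obtain ⟨k, hk⟩ := hA.baer_left.exists_eq_sum_comp φ LinearMap.id (by
    intro a ha
    by_contra hne
    obtain ⟨b, hb, hba⟩ := hno a hne
    have hle : Ideal.span (s : Set Aᵐᵒᵖ) ≤ LinearMap.ker (LinearMap.toSpanSingleton Aᵐᵒᵖ A a) :=
      Ideal.span_le.2 fun x hx => ha ⟨x, hx⟩
    exact hba (hle hb))
  refine hI ((Ideal.eq_top_iff_one _).2 ?_)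
  rw [show (1 : Aᵐᵒᵖ) = _ from congrArg op (hk 1), Finset.op_sum]
  refine Ideal.sum_mem _ fun x _ => ?_
  have h1 : φ x 1 = unop (x : Aᵐᵒᵖ) • (1 : A) := (one_mul _).trans (mul_one _).symm
  rw [h1, map_smul, smul_eq_mul, op_mul, op_unop]
  exact Ideal.mul_mem_left _ _ (Ideal.subset_span x.2)

end QF

/-! ### Dual rings and coideals -/

section CoringDual

variable {A C : Type*} [Ring A] [AddCommGroup C] [Module A C] [Module Aᵐᵒᵖ C]
  [SMulCommClass A Aᵐᵒᵖ C] [Coring A C]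

/-! ### Compatibility of the two dual actions. -/

theorem actL_actR (f : C →ₗ[A] A) (g : C →ₗ[Aᵐᵒᵖ] A) (c : C) :
    actL f (actR g c) = actR g (actL f c) := by
  have h : ∀ t : BTensor A C C, evalRight f (map (actR g) LinearMap.id t) =
      actR g (evalRight f t) := by
    intro t
    induction t using BTensor.induction_on with
    | h0 => simp only [map_zero]
    | ht m n => exact (map_smul (actR g) (op (f n)) m).symm
    | ha s t hs ht => simp only [map_add, hs, ht]
  exact (congrArg (evalRight f) (comul_actR g c)).trans (h _)

instance : SMulCommClass (LeftDual A C) (RightDual A C)ᵐᵒᵖ C :=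
  ⟨fun f g c => actL_actR (A := A) f (unop g) c⟩

/-- Both sides are `∑ g(c₁) f(c₂)`. This exchange converts vanishing of a form on a subbimodule into
annihilation of the subbimodule. -/
theorem apply_actR_eq_apply_actL (f : C →ₗ[A] A) (g : C →ₗ[Aᵐᵒᵖ] A) (c : C) :
    f (actR g c) = g (actL f c) := by
  have h : ∀ t : BTensor A C C, f (evalLeft g t) = g (evalRight f t) := by
    intro t
    induction t using BTensor.induction_on with
    | h0 => simp only [map_zero]
    | ht m n => exact (map_smul f (g m) n).trans (map_smul g (op (f n)) m).symm
    | ha s t hs ht => simp only [map_add, hs, ht]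
  exact h _

instance : FaithfulSMul (RightDual A C)ᵐᵒᵖ C where
  eq_of_smul_eq_smul {f g} h := unop_injective <|
    (fun f g : C →ₗ[Aᵐᵒᵖ] A => fun h : ∀ c, actR f c = actR g c => LinearMap.ext fun c => by
      rw [← counit_actR f, ← counit_actR g, h] : ∀ f g : C →ₗ[Aᵐᵒᵖ] A, (∀ c, actR f c = actR g c) →
        f = g) (unop f) (unop g) h

instance : FaithfulSMul (LeftDual A C) C where
  eq_of_smul_eq_smul {f g} h :=
    (fun f g : C →ₗ[A] A => fun h : ∀ c, actL f c = actL g c => LinearMap.ext fun c => by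
      rw [← counit_actL f, ← counit_actL g, h] : ∀ f g : C →ₗ[A] A, (∀ c, actL f c = actL g c) →
        f = g) f g h

/-- The left linear form `c ↦ ε(c) a`. -/
def counitMulRight (C : Type*) [AddCommGroup C] [Module A C] [Module Aᵐᵒᵖ C]
    [SMulCommClass A Aᵐᵒᵖ C] [Coring A C] (a : A) : C →ₗ[A] A :=
  (LinearMap.toSpanSingleton A A a).comp (counitL A C)

/-- The right linear form `c ↦ a ε(c)`. -/
def counitMulLeft (C : Type*) [AddCommGroup C] [Module A C] [Module Aᵐᵒᵖ C]
    [SMulCommClass A Aᵐᵒᵖ C] [Coring A C] (a : A) : C →ₗ[Aᵐᵒᵖ] A :=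
  (Module.toModuleEnd Aᵐᵒᵖ (S := A) A a).comp (counitR A C)

/-- The right `A`-action is part of the `*C`-action, so `*C`-stable subgroups are right
`A`-submodules. -/
theorem actL_counitMulRight (a : A) (c : C) : actL (counitMulRight C a) c = op a • c := by
  have h : ∀ t : BTensor A C C, evalRight (counitMulRight C a) t =
      op a • evalRight (counitL A C) t := by
    intro t
    induction t using BTensor.induction_on with
    | h0 => simp only [map_zero, smul_zero]
    | ht m n =>
      exact (congrArg (· • m) (op_mul (counit n) a)).trans (mul_smul _ _ _)
    | ha s t hs ht => simp only [map_add, smul_add, hs, ht]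
  exact (h _).trans (congrArg _ (actL_counit c))

theorem actR_counitMulLeft (a : A) (c : C) : actR (counitMulLeft C a) c = a • c := by
  have h : ∀ t : BTensor A C C, evalLeft (counitMulLeft C a) t =
      a • evalLeft (counitR A C) t := by
    intro t
    induction t using BTensor.induction_on with
    | h0 => simp only [map_zero, smul_zero]
    | ht m n => exact mul_smul a (counit m) n
    | ha s t hs ht => simp only [map_add, smul_add, hs, ht]
  exact (h _).trans (congrArg _ (actR_counit c))

/-! ### Coideals as stable submodules. -/

theorem IsRightCoideal.actL_mem {K : Submodule Aᵐᵒᵖ C} (hK : IsRightCoideal K)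
    (f : C →ₗ[A] A) {c : C} (hc : c ∈ K) : actL f c ∈ K := by
  obtain ⟨t, ht⟩ := hK c hc
  have h : ∀ t : BTensor A K C, evalRight f (map K.subtype LinearMap.id t) ∈ K := by
    intro t
    induction t using BTensor.induction_on with
    | h0 => rw [map_zero, map_zero]; exact K.zero_mem
    | ht m n => exact K.smul_mem _ m.2
    | ha s t hs ht => rw [map_add, map_add]; exact K.add_mem hs ht
  have := h t
  rw [ht] at this
  exact this

theorem IsLeftCoideal.actR_mem {K : Submodule A C} (hK : IsLeftCoideal K)
    (f : C →ₗ[Aᵐᵒᵖ] A) {c : C} (hc : c ∈ K) : actR f c ∈ K := by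
  obtain ⟨t, ht⟩ := hK c hc
  have h : ∀ t : BTensor A C K, evalLeft f (map LinearMap.id K.subtype t) ∈ K := by
    intro t
    induction t using BTensor.induction_on with
    | h0 => rw [map_zero, map_zero]; exact K.zero_mem
    | ht m n => exact K.smul_mem _ n.2
    | ha s t hs ht => rw [map_add, map_add]; exact K.add_mem hs ht
  have := h t
  rw [ht] at this
  exact this

theorem BTensor.tmul_finset_sum {M N ι : Type*} [AddCommGroup M] [AddCommGroup N]
    [Module Aᵐᵒᵖ M] [Module A N] (m : M) (s : Finset ι) (n : ι → N) :
    tmul A m (∑ i ∈ s, n i) = ∑ i ∈ s, tmul A m (n i) :=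
  map_sum (mk A M N m) n s

theorem BTensor.finset_sum_tmul {M N ι : Type*} [AddCommGroup M] [AddCommGroup N]
    [Module Aᵐᵒᵖ M] [Module A N] (s : Finset ι) (m : ι → M) (n : N) :
    tmul A (∑ i ∈ s, m i) n = ∑ i ∈ s, tmul A (m i) n :=
  map_sum ((mk A M N).flip n) m s

/-- The dual basis expansion in the right factor of `M ⊗_A N`, for `N` projective. -/
theorem BTensor.exists_finset_eq_sum_evalRight {M N : Type*} [AddCommGroup M] [AddCommGroup N]
    [Module Aᵐᵒᵖ M] [Module A N] [Module.Projective A N] (t : BTensor A M N) :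
    ∃ (s : Finset N) (f : N → N →ₗ[A] A), t = ∑ e ∈ s, tmul A (evalRight (f e) t) e := by
  classical
  obtain ⟨σ, hσ⟩ := (inferInstance : Module.Projective A N)
  let f : N → N →ₗ[A] A := fun e => Finsupp.lapply e ∘ₗ σ
  -- Asking for the expansion over every larger finite set lets the two sums in the additive case be
  -- taken over a common union.
  suffices h : ∃ s₀ : Finset N, ∀ s, s₀ ⊆ s → t = ∑ e ∈ s, tmul A (evalRight (f e) t) e by
    obtain ⟨s, hs⟩ := h
    exact ⟨s, f, hs s subset_rfl⟩
  induction t using BTensor.induction_on with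
  | h0 => exact ⟨∅, fun s _ => by simp only [map_zero, zero_tmul, Finset.sum_const_zero]⟩
  | ht m n =>
    refine ⟨(σ n).support, fun s hs => ?_⟩
    conv_lhs => rw [← hσ n, Finsupp.linearCombination_apply,
      Finsupp.sum_of_support_subset _ hs _ (by simp), tmul_finset_sum]
    exact Finset.sum_congr rfl fun e _ => (smul_tmul m (σ n e) e).symm
  | ha x y hx hy =>
    obtain ⟨sx, hx⟩ := hx
    obtain ⟨sy, hy⟩ := hy
    refine ⟨sx ∪ sy, fun s hs => ?_⟩
    simp only [map_add, add_tmul, Finset.sum_add_distrib]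
    rw [← hx s (Finset.union_subset_left hs), ← hy s (Finset.union_subset_right hs)]

/-- The dual basis expansion in the left factor of `M ⊗_A N`, for `M` projective. -/
theorem BTensor.exists_finset_eq_sum_evalLeft {M N : Type*} [AddCommGroup M] [AddCommGroup N]
    [Module Aᵐᵒᵖ M] [Module A N] [Module.Projective Aᵐᵒᵖ M] (t : BTensor A M N) :
    ∃ (s : Finset M) (f : M → M →ₗ[Aᵐᵒᵖ] A), t = ∑ e ∈ s, tmul A e (evalLeft (f e) t) := by
  classical
  obtain ⟨σ, hσ⟩ := (inferInstance : Module.Projective Aᵐᵒᵖ M)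
  let f : M → M →ₗ[Aᵐᵒᵖ] A := fun e =>
    (opLinearEquiv Aᵐᵒᵖ (M := A)).symm.toLinearMap ∘ₗ Finsupp.lapply e ∘ₗ σ
  suffices h : ∃ s₀ : Finset M, ∀ s, s₀ ⊆ s → t = ∑ e ∈ s, tmul A e (evalLeft (f e) t) by
    obtain ⟨s, hs⟩ := h
    exact ⟨s, f, hs s subset_rfl⟩
  induction t using BTensor.induction_on with
  | h0 =>
    refine ⟨∅, fun s _ => (Finset.sum_eq_zero fun e _ => ?_).symm⟩
    rw [map_zero]
    exact map_zero (mk A M N e)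
  | ht m n =>
    refine ⟨(σ m).support, fun s hs => ?_⟩
    conv_lhs => rw [← hσ m, Finsupp.linearCombination_apply,
      Finsupp.sum_of_support_subset _ hs _ (by simp), finset_sum_tmul]
    exact Finset.sum_congr rfl fun e _ => smul_tmul e (unop (σ m e)) n
  | ha x y hx hy =>
    obtain ⟨sx, hx⟩ := hx
    obtain ⟨sy, hy⟩ := hy
    refine ⟨sx ∪ sy, fun s hs => ?_⟩
    simp only [map_add, tmul_add, Finset.sum_add_distrib]
    rw [← hx s (Finset.union_subset_left hs), ← hy s (Finset.union_subset_right hs)]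

/-- The dual basis expansion reads `Δ(c) = ∑ (f_e ⇀ c) ⊗ e`, and its left factors lie in `K`. -/
theorem isRightCoideal_of_actL_mem [Module.Projective A C] {K : Submodule Aᵐᵒᵖ C}
    (hK : ∀ (f : C →ₗ[A] A), ∀ c ∈ K, actL f c ∈ K) : IsRightCoideal K := by
  intro c hc
  obtain ⟨s, f, hs⟩ := exists_finset_eq_sum_evalRight (comul c : BTensor A C C)
  rw [hs]
  exact AddSubgroup.sum_mem _ fun e _ => ⟨tmul A ⟨_, hK (f e) c hc⟩ e, rfl⟩

theorem isLeftCoideal_of_actR_mem [Module.Projective Aᵐᵒᵖ C] {K : Submodule A C}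
    (hK : ∀ (f : C →ₗ[Aᵐᵒᵖ] A), ∀ c ∈ K, actR f c ∈ K) : IsLeftCoideal K := by
  intro c hc
  obtain ⟨s, f, hs⟩ := exists_finset_eq_sum_evalLeft (comul c : BTensor A C C)
  rw [hs]
  exact AddSubgroup.sum_mem _ fun e _ => ⟨tmul A e ⟨_, hK (f e) c hc⟩, rfl⟩

theorem isRightColinear_actR (g : C →ₗ[Aᵐᵒᵖ] A) : IsRightColinear (actR (C := C) g) :=
  comul_actR g

theorem isLeftColinear_actL (f : C →ₗ[A] A) : IsLeftColinear (actL (C := C) f) :=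
  comul_actL f

/-- Apply `ε` to the left factor of the colinearity identity. With `isRightColinear_actR`, this
identifies the right colinear endomorphisms with the actions of `C*`. -/
theorem IsRightColinear.eq_actR {f : C →ₗ[Aᵐᵒᵖ] C} (hf : IsRightColinear f) (c : C) :
    f c = actR ((counitR A C).comp f) c := by
  have h : ∀ t : BTensor A C C, evalLeft (counitR A C) (map f LinearMap.id t) =
      evalLeft ((counitR A C).comp f) t := by
    intro t
    induction t using BTensor.induction_on with
    | h0 => simp only [map_zero]
    | ht m n => rfl
    | ha s t hs ht => simp only [map_add, hs, ht]
  exact (actR_counit (f c)).symm.trans ((congrArg _ (hf c)).trans (h _))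

theorem IsLeftColinear.eq_actL {f : C →ₗ[A] C} (hf : IsLeftColinear f) (c : C) :
    f c = actL ((counitL A C).comp f) c := by
  have h : ∀ t : BTensor A C C, evalRight (counitL A C) (map LinearMap.id f t) =
      evalRight ((counitL A C).comp f) t := by
    intro t
    induction t using BTensor.induction_on with
    | h0 => simp only [map_zero]
    | ht m n => rfl
    | ha s t hs ht => simp only [map_add, hs, ht]
  exact (actL_counit (f c)).symm.trans ((congrArg _ (hf c)).trans (h _))

theorem isFullyInvariantRightCoideal_iff [Module.Projective A C] {K : Submodule Aᵐᵒᵖ C} :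
    IsFullyInvariantRightCoideal K ↔ (∀ (f : C →ₗ[A] A), ∀ c ∈ K, actL f c ∈ K) ∧
      ∀ (g : C →ₗ[Aᵐᵒᵖ] A), ∀ c ∈ K, actR g c ∈ K := by
  constructor
  · exact fun h => ⟨fun f c => h.1.actL_mem f, fun g => h.2 _ (isRightColinear_actR g)⟩
  · refine fun h => ⟨isRightCoideal_of_actL_mem h.1, fun f hf c hc => ?_⟩
    rw [hf.eq_actR]
    exact h.2 _ c hc

theorem isFullyInvariantLeftCoideal_iff [Module.Projective Aᵐᵒᵖ C] {K : Submodule A C} :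
    IsFullyInvariantLeftCoideal K ↔ (∀ (f : C →ₗ[A] A), ∀ c ∈ K, actL f c ∈ K) ∧
      ∀ (g : C →ₗ[Aᵐᵒᵖ] A), ∀ c ∈ K, actR g c ∈ K := by
  constructor
  · exact fun h => ⟨fun f => h.2 _ (isLeftColinear_actL f), fun g c => h.1.actR_mem g⟩
  · refine fun h => ⟨isLeftCoideal_of_actR_mem h.2, fun f hf c hc => ?_⟩
    rw [hf.eq_actL]
    exact h.1 _ c hc

/-! ### Annihilator conditions over a quasi-Frobenius base. -/

theorem eq_zero_of_forall_dual_apply_eq_zero {B M : Type*} [Ring B] [AddCommGroup M] [Module B M]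
    [Module.Projective B M] {m : M} (h : ∀ f : M →ₗ[B] B, f m = 0) : m = 0 := by
  obtain ⟨σ, hσ⟩ := (inferInstance : Module.Projective B M)
  have : σ m = 0 := Finsupp.ext fun e => h (Finsupp.lapply e ∘ₗ σ)
  rw [← hσ m, this, map_zero]

/-- An additive subgroup of `C` that is stable under `C*`, as a left `A`-submodule. -/
def AddSubgroup.toLeftSubmodule (K : AddSubgroup C)
    (hK : ∀ (g : C →ₗ[Aᵐᵒᵖ] A), ∀ c ∈ K, actR g c ∈ K) : Submodule A C where
  __ := K
  smul_mem' a c hc := actR_counitMulLeft a c ▸ hK (counitMulLeft C a) c hc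

/-- An additive subgroup of `C` that is stable under `*C`, as a right `A`-submodule. -/
def AddSubgroup.toRightSubmodule (K : AddSubgroup C)
    (hK : ∀ (f : C →ₗ[A] A), ∀ c ∈ K, actL f c ∈ K) : Submodule Aᵐᵒᵖ C where
  __ := K
  smul_mem' a c hc := actL_counitMulRight (unop a) c ▸ hK (counitMulRight C (unop a)) c hc

/-- Since `A` is an injective cogenerator, some non-zero `g` vanishes on `K`. For `k ∈ K`, every
left linear form `f` gives `f(k ↼ g) = g(f ⇀ k) = 0`, so `k ↼ g = 0` by projectivity. -/
theorem annihilator_ne_bot_right (hA : IsQFRing A) [Module.Projective A C]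
    (K : Submodule (RightDual A C)ᵐᵒᵖ C) (hK : ∀ f : LeftDual A C, ∀ c ∈ K, f • c ∈ K)
    (hne : K ≠ ⊤) : Module.annihilator (RightDual A C)ᵐᵒᵖ K ≠ ⊥ := by
  intro hbot
  obtain ⟨c, -, hc⟩ := SetLike.exists_of_lt (lt_top_iff_ne_top.2 hne)
  have hc' : c ∉ K.toAddSubgroup.toRightSubmodule hK := hc
  obtain ⟨g, hgK, hgc⟩ := hA.baer_right.exists_linearMap_apply_ne_zero hA.exists_ne_zero_right hc'
  have hg : op (show RightDual A C from g) ∈ Module.annihilator (RightDual A C)ᵐᵒᵖ K := by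
    rw [Module.mem_annihilator]
    intro k
    refine Subtype.ext (eq_zero_of_forall_dual_apply_eq_zero (B := A) fun f => ?_)
    exact (apply_actR_eq_apply_actL f g k).trans (hgK _ (hK f k k.2))
  rw [hbot] at hg
  have hg0 : g = 0 := op_injective hg
  exact hgc (by rw [hg0, LinearMap.zero_apply])

theorem annihilator_ne_bot_left (hA : IsQFRing A) [Module.Projective Aᵐᵒᵖ C]
    (K : Submodule (LeftDual A C) C) (hK : ∀ g : (RightDual A C)ᵐᵒᵖ, ∀ c ∈ K, g • c ∈ K)
    (hne : K ≠ ⊤) : Module.annihilator (LeftDual A C) K ≠ ⊥ := by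
  intro hbot
  obtain ⟨c, -, hc⟩ := SetLike.exists_of_lt (lt_top_iff_ne_top.2 hne)
  have hc' : c ∉ K.toAddSubgroup.toLeftSubmodule fun g => hK (op g) := hc
  obtain ⟨f, hfK, hfc⟩ := hA.baer_left.exists_linearMap_apply_ne_zero hA.exists_ne_zero_left hc'
  have hf : (show LeftDual A C from f) ∈ Module.annihilator (LeftDual A C) K := by
    rw [Module.mem_annihilator]
    intro k
    refine Subtype.ext (eq_zero_of_forall_dual_apply_eq_zero (B := Aᵐᵒᵖ) fun g => ?_)
    -- Projectivity over `Aᵐᵒᵖ` supplies forms with values in `Aᵐᵒᵖ`; `g'` is the corresponding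
    -- element of `C*`.
    let g' : C →ₗ[Aᵐᵒᵖ] A := (opLinearEquiv Aᵐᵒᵖ (M := A)).symm.toLinearMap ∘ₗ g
    refine unop_injective (show g' (actL f (k : C)) = 0 from ?_)
    exact (apply_actR_eq_apply_actL f g' k).symm.trans (hfK _ (hK (op g') k k.2))
  rw [hbot] at hf
  have hf0 : f = 0 := hf
  exact hfc (by rw [hf0, LinearMap.zero_apply])

/-- Evaluation at `c` on `C*`. -/
def RightDual.evalHom (c : C) : RightDual A C →+ A where
  toFun f := (show C →ₗ[Aᵐᵒᵖ] A from f) c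
  map_zero' := rfl
  map_add' _ _ := rfl

/-- Evaluation at `c` on `*C`. -/
def LeftDual.evalHom (c : C) : LeftDual A C →+ A where
  toFun f := (show C →ₗ[A] A from f) c
  map_zero' := rfl
  map_add' _ _ := rfl

theorem RightDual.ext_evalHom {f g : RightDual A C} (h : ∀ c, evalHom c f = evalHom c g) :
    f = g :=
  LinearMap.ext h

theorem LeftDual.ext_evalHom {f g : LeftDual A C} (h : ∀ c, evalHom c f = evalHom c g) :
    f = g :=
  LinearMap.ext h

/-- The form `t` vanishes wherever the finitely many generators of `I` act as zero. Injectivity of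
`A` then writes it as a sum of forms composed with the actions of the generators, and such
composites are convolution products. -/
theorem mem_ideal_of_forall_smul_eq_zero_right (hA : IsQFRing A)
    [IsNoetherianRing (RightDual A C)ᵐᵒᵖ] (I : Ideal (RightDual A C)ᵐᵒᵖ)
    (t : (RightDual A C)ᵐᵒᵖ) (ht : ∀ c : C, (∀ i ∈ I, i • c = 0) → t • c = 0) : t ∈ I := by
  obtain ⟨s, rfl⟩ := (isNoetherianRing_iff_ideal_fg _).1 inferInstance I
  obtain ⟨k, hk⟩ := hA.baer_right.exists_eq_sum_comp (M := C) (N := C) (ι := s)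
    (fun i => actR (unop (i : (RightDual A C)ᵐᵒᵖ))) (unop t) (by
      intro c hc
      have h0 : t • c = 0 := ht c fun i hi => by
        have hle : Ideal.span (s : Set (RightDual A C)ᵐᵒᵖ) ≤
            LinearMap.ker (LinearMap.toSpanSingleton (RightDual A C)ᵐᵒᵖ C c) :=
          Ideal.span_le.2 fun x hx => hc ⟨x, hx⟩
        exact hle hi
      exact (counit_actR _ c).symm.trans ((congrArg _ h0).trans (map_zero _)))
  -- In `C*` the composite `k i ∘ (↼ i)` is the product of `i` by `k i`; in the opposite ring `i`
  -- becomes the right factor, as membership in a left ideal requires.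
  have ht' : t = ∑ i : s, op (show RightDual A C from k i) * (i : (RightDual A C)ᵐᵒᵖ) := by
    refine unop_injective (Eq.trans ?_ (Finset.unop_sum _ _).symm)
    refine RightDual.ext_evalHom fun c => ?_
    rw [map_sum]
    exact hk c
  rw [ht']
  exact Ideal.sum_mem _ fun i _ => Ideal.mul_mem_left _ _ (Ideal.subset_span i.2)

theorem mem_ideal_of_forall_smul_eq_zero_left (hA : IsQFRing A)
    [IsNoetherianRing (LeftDual A C)] (I : Ideal (LeftDual A C))
    (t : LeftDual A C) (ht : ∀ c : C, (∀ i ∈ I, i • c = 0) → t • c = 0) : t ∈ I := by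
  obtain ⟨s, rfl⟩ := (isNoetherianRing_iff_ideal_fg _).1 inferInstance I
  obtain ⟨k, hk⟩ := hA.baer_left.exists_eq_sum_comp (M := C) (N := C) (ι := s)
    (fun i => actL (i : LeftDual A C)) t (by
      intro c hc
      have h0 : t • c = 0 := ht c fun i hi => by
        have hle : Ideal.span (s : Set (LeftDual A C)) ≤
            LinearMap.ker (LinearMap.toSpanSingleton (LeftDual A C) C c) :=
          Ideal.span_le.2 fun x hx => hc ⟨x, hx⟩
        exact hle hi
      exact (counit_actL _ c).symm.trans ((congrArg _ h0).trans (map_zero _)))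
  have ht' : t = ∑ i : s, (show LeftDual A C from k i) * (i : LeftDual A C) := by
    refine LeftDual.ext_evalHom fun c => ?_
    rw [map_sum]
    exact hk c
  rw [ht']
  exact Ideal.sum_mem _ fun i _ => Ideal.mul_mem_left _ _ (Ideal.subset_span i.2)

/-! ### Full coprimeness and simplicity in terms of subbimodules. -/

theorem BTensor.map_id_id {M N : Type*} [AddCommGroup M] [AddCommGroup N]
    [Module Aᵐᵒᵖ M] [Module A N] (t : BTensor A M N) :
    map (LinearMap.id : M →ₗ[Aᵐᵒᵖ] M) (LinearMap.id : N →ₗ[A] N) t = t :=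
  DFunLike.congr_fun (hom_ext (f := map LinearMap.id LinearMap.id) (g := AddMonoidHom.id _)
    fun _ _ => rfl) t

theorem mem_rightInternalCoproduct {X Y : Submodule Aᵐᵒᵖ C} {c : C} :
    c ∈ rightInternalCoproduct X Y ↔
      ∀ f : C →ₗ[Aᵐᵒᵖ] C, IsRightColinear f → (∀ x ∈ X, f x = 0) → f c ∈ Y := by
  simp only [rightInternalCoproduct, Submodule.mem_iInf, Submodule.mem_comap, Subtype.forall,
    and_imp]

theorem mem_leftInternalCoproduct {X Y : Submodule A C} {c : C} :
    c ∈ leftInternalCoproduct X Y ↔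
      ∀ f : C →ₗ[A] C, IsLeftColinear f → (∀ x ∈ X, f x = 0) → f c ∈ Y := by
  simp only [leftInternalCoproduct, Submodule.mem_iInf, Submodule.mem_comap, Subtype.forall,
    and_imp]

theorem isRightFullyCoprime_of_trivial [Nontrivial C]
    (h : ∀ K : Submodule Aᵐᵒᵖ C, IsFullyInvariantRightCoideal K → K = ⊥ ∨ K = ⊤) :
    IsRightFullyCoprime A C := by
  refine ⟨inferInstance, fun X Y hX _ hXY => ?_⟩
  refine (h X hX).symm.imp (fun h => h.ge) fun hbot c hc => ?_
  -- When `X = 0` the identity is an admissible endomorphism, which forces `Y = C`.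
  refine mem_rightInternalCoproduct.1 (hXY hc) LinearMap.id (fun d => ?_) fun x hx => ?_
  · exact (map_id_id _).symm
  · rw [hbot] at hx; exact hx

theorem isLeftFullyCoprime_of_trivial [Nontrivial C]
    (h : ∀ K : Submodule A C, IsFullyInvariantLeftCoideal K → K = ⊥ ∨ K = ⊤) :
    IsLeftFullyCoprime A C := by
  refine ⟨inferInstance, fun X Y hX _ hXY => ?_⟩
  refine (h X hX).symm.imp (fun h => h.ge) fun hbot c hc => ?_
  refine mem_leftInternalCoproduct.1 (hXY hc) LinearMap.id (fun d => ?_) fun x hx => ?_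
  · exact (map_id_id _).symm
  · rw [hbot] at hx; exact hx

theorem IsRightFullyCoprime.eq_top_or_eq_top [Module.Projective A C]
    (h : IsRightFullyCoprime A C) (X Y : Submodule (RightDual A C)ᵐᵒᵖ C)
    (hX : ∀ f : LeftDual A C, ∀ c ∈ X, f • c ∈ X) (hY : ∀ f : LeftDual A C, ∀ c ∈ Y, f • c ∈ Y)
    (hXY : ∀ t : (RightDual A C)ᵐᵒᵖ, (∀ x ∈ X, t • x = 0) → ∀ c, t • c ∈ Y) :
    X = ⊤ ∨ Y = ⊤ := by
  have key := h.2 (X.toAddSubgroup.toRightSubmodule hX) (Y.toAddSubgroup.toRightSubmodule hY)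
    (isFullyInvariantRightCoideal_iff.2 ⟨hX, fun g => fun c => X.smul_mem (op g)⟩)
    (isFullyInvariantRightCoideal_iff.2 ⟨hY, fun g => fun c => Y.smul_mem (op g)⟩)
    fun c _ => mem_rightInternalCoproduct.2 fun f hf hfX => by
      rw [hf.eq_actR]
      refine hXY (op ((counitR A C).comp f)) (fun x hx => ?_) c
      exact (hf.eq_actR x).symm.trans (hfX x hx)
  exact key.imp (fun hk => eq_top_iff.2 fun c _ => hk (Submodule.mem_top : c ∈ _))
    (fun hk => eq_top_iff.2 fun c _ => hk (Submodule.mem_top : c ∈ _))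

theorem IsLeftFullyCoprime.eq_top_or_eq_top [Module.Projective Aᵐᵒᵖ C]
    (h : IsLeftFullyCoprime A C) (X Y : Submodule (LeftDual A C) C)
    (hX : ∀ g : (RightDual A C)ᵐᵒᵖ, ∀ c ∈ X, g • c ∈ X)
    (hY : ∀ g : (RightDual A C)ᵐᵒᵖ, ∀ c ∈ Y, g • c ∈ Y)
    (hXY : ∀ t : LeftDual A C, (∀ x ∈ X, t • x = 0) → ∀ c, t • c ∈ Y) :
    X = ⊤ ∨ Y = ⊤ := by
  have key := h.2 (X.toAddSubgroup.toLeftSubmodule fun g => hX (op g))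
    (Y.toAddSubgroup.toLeftSubmodule fun g => hY (op g))
    (isFullyInvariantLeftCoideal_iff.2 ⟨fun f => fun c => X.smul_mem f, fun g => hX (op g)⟩)
    (isFullyInvariantLeftCoideal_iff.2 ⟨fun f => fun c => Y.smul_mem f, fun g => hY (op g)⟩)
    fun c _ => mem_leftInternalCoproduct.2 fun f hf hfX => by
      rw [hf.eq_actL]
      refine hXY ((counitL A C).comp f) (fun x hx => ?_) c
      exact (hf.eq_actL x).symm.trans (hfX x hx)
  exact key.imp (fun hk => eq_top_iff.2 fun c _ => hk (Submodule.mem_top : c ∈ _))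
    (fun hk => eq_top_iff.2 fun c _ => hk (Submodule.mem_top : c ∈ _))

theorem isSimpleCoring_iff_rightCoideal [Nontrivial C] [Module.Projective A C] :
    IsSimpleCoring A C ↔
      ∀ K : Submodule Aᵐᵒᵖ C, IsFullyInvariantRightCoideal K → K = ⊥ ∨ K = ⊤ := by
  constructor
  · intro h K hK
    rw [isFullyInvariantRightCoideal_iff] at hK
    exact (h.2 K.toAddSubgroup hK.1 hK.2).imp
      (fun h => Submodule.toAddSubgroup_injective h) (fun h => Submodule.toAddSubgroup_injective h)
  · refine fun h => ⟨inferInstance, fun K hf hg => ?_⟩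
    exact (h (K.toRightSubmodule hf) (isFullyInvariantRightCoideal_iff.2 ⟨hf, hg⟩)).imp
      (congrArg Submodule.toAddSubgroup) (congrArg Submodule.toAddSubgroup)

theorem isSimpleCoring_iff_leftCoideal [Nontrivial C] [Module.Projective Aᵐᵒᵖ C] :
    IsSimpleCoring A C ↔
      ∀ K : Submodule A C, IsFullyInvariantLeftCoideal K → K = ⊥ ∨ K = ⊤ := by
  constructor
  · intro h K hK
    rw [isFullyInvariantLeftCoideal_iff] at hK
    exact (h.2 K.toAddSubgroup hK.1 hK.2).imp
      (fun h => Submodule.toAddSubgroup_injective h) (fun h => Submodule.toAddSubgroup_injective h)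
  · refine fun h => ⟨inferInstance, fun K hf hg => ?_⟩
    exact (h (K.toLeftSubmodule hg) (isFullyInvariantLeftCoideal_iff.2 ⟨hf, hg⟩)).imp
      (congrArg Submodule.toAddSubgroup) (congrArg Submodule.toAddSubgroup)

theorem isSimpleCoring_iff_rightDual_submodule [Nontrivial C] :
    IsSimpleCoring A C ↔ ∀ K : Submodule (RightDual A C)ᵐᵒᵖ C,
      (∀ f : LeftDual A C, ∀ c ∈ K, f • c ∈ K) → K = ⊥ ∨ K = ⊤ := by
  constructor
  · intro h K hK
    exact (h.2 K.toAddSubgroup hK fun g c => K.smul_mem (op g)).imp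
      (fun h => Submodule.toAddSubgroup_injective h) (fun h => Submodule.toAddSubgroup_injective h)
  · refine fun h => ⟨inferInstance, fun K hf hg => ?_⟩
    exact (h { K with smul_mem' := fun g c => hg (unop g) c } hf).imp
      (congrArg Submodule.toAddSubgroup) (congrArg Submodule.toAddSubgroup)

theorem isSimpleCoring_iff_leftDual_submodule [Nontrivial C] :
    IsSimpleCoring A C ↔ ∀ K : Submodule (LeftDual A C) C,
      (∀ g : (RightDual A C)ᵐᵒᵖ, ∀ c ∈ K, g • c ∈ K) → K = ⊥ ∨ K = ⊤ := by
  constructor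
  · intro h K hK
    exact (h.2 K.toAddSubgroup (fun f c => K.smul_mem f) fun g => hK (op g)).imp
      (fun h => Submodule.toAddSubgroup_injective h) (fun h => Submodule.toAddSubgroup_injective h)
  · refine fun h => ⟨inferInstance, fun K hf hg => ?_⟩
    exact (h { K with smul_mem' := fun f c => hf f c } fun g => hg (unop g)).imp
      (congrArg Submodule.toAddSubgroup) (congrArg Submodule.toAddSubgroup)

end CoringDual

/-! ### Passage to opposite rings and assembly of the equivalences. -/

theorem IsSimpleArtinianRing.mulOpposite {T : Type*} [Ring T] (h : IsSimpleArtinianRing T) :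
    IsSimpleArtinianRing Tᵐᵒᵖ := by
  have := h.2.2
  exact (isPrimeRing_mulOpposite_iff.2 h.isPrimeRing).isSimpleArtinianRing

theorem isSimpleArtinianRing_mulOpposite_iff {T : Type*} [Ring T] :
    IsSimpleArtinianRing Tᵐᵒᵖ ↔ IsSimpleArtinianRing T := by
  refine ⟨fun h => ?_, IsSimpleArtinianRing.mulOpposite⟩
  have := h.2.1
  have hss : IsSemisimpleRing Tᵐᵒᵖ := by
    have := h.1
    exact IsSimpleRing.isSemisimpleRing_iff_isArtinianRing.2 h.2.1
  have : IsSemisimpleRing T := isSemisimpleRing_mulOpposite_iff.1 hss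
  exact (isPrimeRing_mulOpposite_iff.1 h.isPrimeRing).isSimpleArtinianRing

theorem theorem5 {A : Type*} {C : Type*} [Ring A] [AddCommGroup C] [Module A C]
    [Module Aᵐᵒᵖ C] [SMulCommClass A Aᵐᵒᵖ C] [Coring A C] [Nontrivial C]
    (hA : IsQFRing A)
    (hCl : Module.Projective A C) (hCr : Module.Projective Aᵐᵒᵖ C)
    (hR : IsArtinianRing (RightDual A C)ᵐᵒᵖ) (hL : IsArtinianRing (LeftDual A C)) :
    List.TFAE [
      IsPrimeRing (RightDual A C),
      IsPrimeRing (LeftDual A C),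
      IsDiprimeModule (RightDual A C)ᵐᵒᵖ C,
      IsDiprimeModule (LeftDual A C) C,
      IsPrimeModule (RightDual A C)ᵐᵒᵖ C,
      IsPrimeModule (LeftDual A C) C,
      IsSimpleArtinianRing (RightDual A C),
      IsSimpleArtinianRing (LeftDual A C),
      IsStronglyPrimeModule (RightDual A C)ᵐᵒᵖ C,
      IsStronglyPrimeModule (LeftDual A C) C,
      IsRightFullyCoprime A C,
      IsLeftFullyCoprime A C,
      (∀ K : Submodule Aᵐᵒᵖ C, IsFullyInvariantRightCoideal K → K = ⊥ ∨ K = ⊤),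
      (∀ K : Submodule A C, IsFullyInvariantLeftCoideal K → K = ⊥ ∨ K = ⊤),
      IsSimpleCoring A C] := by
  have := hCl
  have := hCr
  have hcomm : SMulCommClass (RightDual A C)ᵐᵒᵖ (LeftDual A C) C := SMulCommClass.symm _ _ _
  have hright := primeness_tfae_of_faithful_bimodule (RightDual A C)ᵐᵒᵖ (LeftDual A C) C
    (annihilator_ne_bot_right hA) (mem_ideal_of_forall_smul_eq_zero_right hA)
  have hleft := primeness_tfae_of_faithful_bimodule (LeftDual A C) (RightDual A C)ᵐᵒᵖ C
    (annihilator_ne_bot_left hA) (mem_ideal_of_forall_smul_eq_zero_left hA)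
  rw [isPrimeRing_mulOpposite_iff, isSimpleArtinianRing_mulOpposite_iff,
    ← isSimpleCoring_iff_rightDual_submodule] at hright
  rw [← isSimpleCoring_iff_leftDual_submodule] at hleft
  -- Positions in `out` count from 0, those in `tfae_have` from 1. Entry 15, simplicity of the
  -- bimodule, joins the right and left lists.
  tfae_have 1 ↔ 3 := hright.out 0 1
  tfae_have 1 ↔ 5 := hright.out 0 2
  tfae_have 1 ↔ 7 := hright.out 0 3
  tfae_have 1 ↔ 9 := hright.out 0 4
  tfae_have 1 ↔ 15 := hright.out 0 6
  tfae_have 2 ↔ 4 := hleft.out 0 1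
  tfae_have 2 ↔ 6 := hleft.out 0 2
  tfae_have 2 ↔ 8 := hleft.out 0 3
  tfae_have 2 ↔ 10 := hleft.out 0 4
  tfae_have 2 ↔ 15 := hleft.out 0 6
  tfae_have 15 ↔ 13 := isSimpleCoring_iff_rightCoideal
  tfae_have 15 ↔ 14 := isSimpleCoring_iff_leftCoideal
  tfae_have 13 → 11 := isRightFullyCoprime_of_trivial
  tfae_have 14 → 12 := isLeftFullyCoprime_of_trivial
  -- Only this direction is needed from the abstract coprimeness condition; the converse comes from
  -- the absence of fully invariant coideals.
  tfae_have 11 → 1 := fun h => (hright.out 5 0).1 h.eq_top_or_eq_top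
  tfae_have 12 → 2 := fun h => (hleft.out 5 0).1 h.eq_top_or_eq_top
  tfae_finish
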